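/- **Setting.** Let $\mathcal M=(\mathcal S,\mathcal A,p,q,\gamma)$ be a finite MDP with discount factor $\gamma\in[0,1)$, transition probabilities $p(s'|s,a)$, and reward laws $q(\cdot|s,a)$ supported in $[0,1]$ with means $r(s,a)$. Put $S=|\mathcal S|$, $A=|\mathcal A|\ge 1$, $\mathcal Z=\mathcal S\times\mathcal A$. For a deterministic policy $\pi:\mathcal S\to\mathcal A$ let $P_\pi$ be its transition matrix on $\mathcal S$ and $V^\pi(s)=\sum_{t\ge0}\gamma^t (P_\pi^t r_\pi)(s)$ with $r_\pi(s)=r(s,\pi(s))$. Let $V^\star=\max_\pi V^\pi$, $Q^\star(s,a)=r(s,a)+\gamma\sum_{s'}p(s'|s,a)V^\star(s')$ and $\Delta_{sa}=V^\star(s)-Q^\star(s,a)$. Assume: 1. $\mathcal M$ is communicating (for all $s,s'$ there are $n\ge1$ and $\pi:\mathcal S\to\mathcal A$ with $P_\pi^n(s,s')>0$) and has a unique optimal policy $\pi^\star$. MDPs with these two properties are called admissible. 2. The chain on $\mathcal Z$ induced by the uniform policy $\pi_u(a|s)=1/A$ is aperiodic. 3. The oracle weights $\omega^\star$ defined below are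 unique. **Oracle weights.** Let $\Omega(\mathcal M)$ be the set of probability vectors $\omega$ on $\mathcal Z$ such that $\sum_a\omega_{sa}=\sum_{s',a'}p(s|s',a')\omega_{s'a'}$ for all $s$, and let $$U(\mathcal M,\omega)=\max_{s,\,a\ne\pi^\star(s)}\frac{H_{sa}}{\omega_{sa}}+\frac{H^\star}{S\,\min_s\omega_{s,\pi^\star(s)}}\in[0,\infty],$$ $$H_{sa}=\frac{2}{\Delta_{sa}^2}+\max\Big(\frac{16\,\mathrm{Var}_{p(\cdot|s,a)}[V^\star]}{\Delta_{sa}^2},\frac{6\,\mathrm{sp}(V^\star)^{4/3}}{\Delta_{sa}^{4/3}}\Big),\qquad H^\star=S(T_3+T_4),\qquad T_3=\frac{2}{\Delta_{\min}^2(1-\gamma)^2},$$ $$T_4=\min\Big(\frac{27}{\Delta_{\min}^2(1-\gamma)^3},\max\Big(\frac{16\max_s\mathrm{Var}_{p(\cdot|s,\pi^\star(s))}[V^\star]}{\Delta_{\min}^2(1-\gamma)^2},\frac{6\,\mathrm{sp}(V^\star)^{4/3}}{\Delta_{\min}^{4/3}(1-\gamma)^{4/3}}\Big)\Big),$$ where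 $\mathrm{sp}(V)=\max V-\min V$ and $\Delta_{\min}=\min_{s,\,a\ne\pi^\star(s)}\Delta_{sa}$ (if $A=1$, then $U\equiv0$). Oracle weights of $\mathcal M$ are minimizers of $U(\mathcal M,\cdot)$ over $\Omega(\mathcal M)$; a policy $\pi$ is an oracle policy of $\mathcal M$ if $\pi(a|s)\sum_b\omega_{sb}=\omega_{sa}$ for all $(s,a)$ and some oracle weights $\omega$ of $\mathcal M$. **Algorithm.** The learner observes $s_0,a_0,R_0,s_1,a_1,R_1,\dots$ from an arbitrary initial state: given the past up to $s_t$, the action $a_t$ has law $\pi_t(\cdot|s_t)$ and, given $a_t$ too, $R_t\sim q(\cdot|s_t,a_t)$ and $s_{t+1}\sim p(\cdot|s_t,a_t)$ are independent. Let $N_{sa}(t)=\#\{k<t:(s_k,a_k)=(s,a)\}$, and let $\widehat{\mathcal M}_t$ be the MDP with the discount factor $\gamma$ and the empirical transition frequencies and mean rewards of the rounds $0,\dots,t-1$. For $t\ge1$ let $\pi^o_t$ be a policy, measurable with respect to the past up to $s_t$, which is an oracle policy of $\widehat{\mathcal M}_t$ (any one of them) whenever all pairs have been visited and $\widehat{\mathcal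 M}_t$ is admissible, and is arbitrary otherwise. The first action is uniform, $\pi_0=\pi_u$, and for $t\ge1$ $$\pi_t=\varepsilon_t\pi_u+(1-\varepsilon_t)\frac1t\sum_{j=1}^t\pi^o_j\quad\text{(C-Navigation)},\qquad \pi_t=\varepsilon_t\pi_u+(1-\varepsilon_t)\pi^o_t\quad\text{(D-Navigation)}.$$ The exploration rates $\varepsilon_t\le1$ are non-increasing in $t\ge1$ with $\varepsilon_t\to0$ and $\varepsilon_t\ge t^{-1/(m+1)}$ for all $t\ge1$, where $m=\max_{s,s'}\min\{n\ge1:\exists\pi:\mathcal S\to\mathcal A,\ P_\pi^n(s,s')>0\}$. **Theorem.** Under either C-Navigation or D-Navigation, almost surely, for all $(s,a)\in\mathcal Z$, $$\lim_{t\to\infty}\frac{N_{sa}(t)}{t}=\omega^\star_{sa}.$$ -/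

import Mathlib

open Filter Topology MeasureTheory ProbabilityTheory

noncomputable section

namespace NavMDP

/-- The data of a finite discounted MDP that matter for planning: transition probabilities
`p s a s' = p(s' | s, a)`, mean rewards `r s a` and the discount factor `γ`. -/
structure Model (S A : Type*) [Fintype S] where
  p : S → A → S → ℝ
  p_nonneg : ∀ s a s', 0 ≤ p s a s'
  p_sum : ∀ s a, ∑ s', p s a s' = 1
  r : S → A → ℝ
  γ : ℝ
  γ_nonneg : 0 ≤ γ
  γ_lt_one : γ < 1

/-- A finite discounted MDP with reward laws supported in `[0, 1]`. -/
structure MDP (S A : Type*) [Fintype S] where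
  p : S → A → S → ℝ
  p_nonneg : ∀ s a s', 0 ≤ p s a s'
  p_sum : ∀ s a, ∑ s', p s a s' = 1
  q : S → A → Measure ℝ
  q_prob : ∀ s a, IsProbabilityMeasure (q s a)
  q_supp : ∀ s a, q s a (Set.Icc 0 1)ᶜ = 0
  γ : ℝ
  γ_nonneg : 0 ≤ γ
  γ_lt_one : γ < 1

/-- The planning data of an MDP; its mean rewards are the means of the reward laws. -/
def MDP.toModel {S A : Type*} [Fintype S] (M : MDP S A) : Model S A where
  p := M.p
  p_nonneg := M.p_nonneg
  p_sum := M.p_sum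
  r := fun s a => ∫ x, x ∂(M.q s a)
  γ := M.γ
  γ_nonneg := M.γ_nonneg
  γ_lt_one := M.γ_lt_one

/-- `π s a = π(a | s)` is a stationary randomized policy. -/
def IsPolicy {S A : Type*} [Fintype A] (π : S → A → ℝ) : Prop :=
  ∀ s, (∀ a, 0 ≤ π s a) ∧ ∑ a, π s a = 1

/-- The uniform policy. -/
def uniformPolicy (S A : Type*) [Fintype A] : S → A → ℝ :=
  fun _ _ => 1 / (Fintype.card A : ℝ)

namespace Model

variable {S A : Type*} [Fintype S] [DecidableEq S] [Fintype A] [DecidableEq A]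

/-- Transition matrix on states of a stationary deterministic policy. -/
def detKernel (M : Model S A) (π : S → A) : Matrix S S ℝ :=
  Matrix.of fun s s' => M.p s (π s) s'

/-- Transition matrix on state-action pairs of a stationary randomized policy. -/
def pairKernel (M : Model S A) (π : S → A → ℝ) : Matrix (S × A) (S × A) ℝ :=
  Matrix.of fun z z' => M.p z.1 z.2 z'.1 * π z'.1 z'.2

/-- Every state can be reached from every state under some deterministic policy. -/
def Communicating (M : Model S A) : Prop :=
  ∀ s s', ∃ n : ℕ, 1 ≤ n ∧ ∃ π : S → A, 0 < (M.detKernel π ^ n) s s'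

/-- Maximum length of the shortest paths between pairs of states. -/
def diam (M : Model S A) : ℕ :=
  Finset.univ.sup fun z : S × S =>
    sInf {n : ℕ | 1 ≤ n ∧ ∃ π : S → A, 0 < (M.detKernel π ^ n) z.1 z.2}

/-- The chain on state-action pairs induced by the uniform policy is aperiodic: at each pair the
possible return times have greatest common divisor one. -/
def UniformAperiodic (M : Model S A) : Prop :=
  ∀ z : S × A, ∀ d : ℕ,
    (∀ n : ℕ, 1 ≤ n → 0 < (M.pairKernel (uniformPolicy S A) ^ n) z z → d ∣ n) → d = 1

/-- Value of a deterministic policy: `V^π(s) = ∑ₜ γᵗ 𝔼[r(sₜ, π(sₜ))]` started at `s`. -/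
def value (M : Model S A) (π : S → A) (s : S) : ℝ :=
  ∑' t : ℕ, M.γ ^ t * ∑ s', (M.detKernel π ^ t) s s' * M.r s' (π s')

/-- Optimal value function. -/
def V (M : Model S A) (s : S) : ℝ := ⨆ π : S → A, M.value π s

/-- Optimal state-action value function. -/
def Q (M : Model S A) (s : S) (a : A) : ℝ := M.r s a + M.γ * ∑ s', M.p s a s' * M.V s'

/-- Sub-optimality gap. -/
def gap (M : Model S A) (s : S) (a : A) : ℝ := M.V s - M.Q s a

def IsOptimalPolicy (M : Model S A) (π : S → A) : Prop := ∀ s, M.value π s = M.V s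

/-- Communicating, with a unique optimal policy. -/
def Admissible (M : Model S A) : Prop :=
  M.Communicating ∧ ∃! π : S → A, M.IsOptimalPolicy π

/-- The optimal policy. -/
def optPolicy [Nonempty A] (M : Model S A) : S → A := Classical.epsilon M.IsOptimalPolicy

/-- Variance of `V(s')` for `s' ∼ p(· | s, a)`. -/
def varV (M : Model S A) (s : S) (a : A) : ℝ :=
  ∑ s', M.p s a s' * (M.V s' - ∑ s'', M.p s a s'' * M.V s'') ^ 2

/-- Span of the optimal value function. -/
def spanV (M : Model S A) : ℝ := (⨆ s, M.V s) - ⨅ s, M.V s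

variable [Nonempty A]

/-- Smallest gap of a state-action pair whose action is not the optimal one. -/
def gapMin (M : Model S A) : ℝ :=
  ⨅ z : {z : S × A // z.2 ≠ M.optPolicy z.1}, M.gap z.1.1 z.1.2

/-- Largest variance along the optimal policy. -/
def varMax (M : Model S A) : ℝ := ⨆ s, M.varV s (M.optPolicy s)

def H (M : Model S A) (s : S) (a : A) : ℝ :=
  2 / M.gap s a ^ 2 +
    max (16 * M.varV s a / M.gap s a ^ 2)
      (6 * M.spanV ^ ((4 : ℝ) / 3) / M.gap s a ^ ((4 : ℝ) / 3))

def T3 (M : Model S A) : ℝ := 2 / (M.gapMin ^ 2 * (1 - M.γ) ^ 2)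

def T4 (M : Model S A) : ℝ :=
  min (27 / (M.gapMin ^ 2 * (1 - M.γ) ^ 3))
    (max (16 * M.varMax / (M.gapMin ^ 2 * (1 - M.γ) ^ 2))
      (6 * M.spanV ^ ((4 : ℝ) / 3) /
        (M.gapMin ^ ((4 : ℝ) / 3) * (1 - M.γ) ^ ((4 : ℝ) / 3))))

def Hstar (M : Model S A) : ℝ := Fintype.card S * (M.T3 + M.T4)

/-- The bound `U(M, ω)` on the characteristic time. It is `[0, ∞]`-valued, with value `∞` when
some weight vanishes. -/
def U (M : Model S A) (ω : S → A → ℝ) : ENNReal :=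
  (⨆ z : {z : S × A // z.2 ≠ M.optPolicy z.1},
      ENNReal.ofReal (M.H z.1.1 z.1.2) / ENNReal.ofReal (ω z.1.1 z.1.2)) +
    ENNReal.ofReal M.Hstar /
      ENNReal.ofReal (Fintype.card S * ⨅ s, ω s (M.optPolicy s))

/-- The navigation-constrained allocations `Ω(M)`: probability vectors on state-action pairs whose
flow into each state equals the flow out of it. -/
def Allocations (M : Model S A) : Set (S → A → ℝ) :=
  {ω | (∀ s a, 0 ≤ ω s a) ∧ ∑ s, ∑ a, ω s a = 1 ∧
    ∀ s, ∑ a, ω s a = ∑ s', ∑ a', M.p s' a' s * ω s' a'}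

/-- `ω` minimizes `U(M, ·)` over `Ω(M)`. -/
def IsOracleWeights (M : Model S A) (ω : S → A → ℝ) : Prop :=
  ω ∈ M.Allocations ∧ ∀ ω' ∈ M.Allocations, M.U ω ≤ M.U ω'

/-- `π(a | s) = ω_{sa} / ∑_b ω_{sb}` for some oracle weights `ω`. -/
def IsOraclePolicy (M : Model S A) (π : S → A → ℝ) : Prop :=
  IsPolicy π ∧ ∃ ω, M.IsOracleWeights ω ∧ ∀ s a, π s a * ∑ b, ω s b = ω s a

end Model

section Empirical

variable {S A : Type*} [Fintype S] [DecidableEq S] [DecidableEq A]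

/-- `N_{sa}(t)`: number of visits to `(s, a)` during the first `t` rounds `0, …, t - 1`. -/
def visits (st : ℕ → S) (act : ℕ → A) (t : ℕ) (s : S) (a : A) : ℕ :=
  ((Finset.range t).filter fun k => st k = s ∧ act k = a).card

/-- Number of observed transitions `(s, a, s')` during the first `t` rounds. -/
def transCount (st : ℕ → S) (act : ℕ → A) (t : ℕ) (s : S) (a : A) (s' : S) : ℕ :=
  ((Finset.range t).filter fun k => (st k = s ∧ act k = a) ∧ st (k + 1) = s').card

theorem sum_transCount (st : ℕ → S) (act : ℕ → A) (t : ℕ) (s : S) (a : A) :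
    ∑ s', transCount st act t s a s' = visits st act t s a := by
  unfold transCount visits
  rw [Finset.card_eq_sum_card_fiberwise (f := fun k => st (k + 1)) (t := Finset.univ)
    (fun _ _ => Finset.mem_coe.2 (Finset.mem_univ _))]
  simp only [Finset.filter_filter]

/-- The empirical model after `t` rounds: empirical transition frequencies (uniform at pairs not
yet visited) and empirical mean rewards (`0` at pairs not yet visited). -/
def empModel (γ : ℝ) (h0 : 0 ≤ γ) (h1 : γ < 1) (st : ℕ → S) (act : ℕ → A) (rew : ℕ → ℝ) (t : ℕ) :
    Model S A where
  p := fun s a s' =>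
    if visits st act t s a = 0 then 1 / (Fintype.card S : ℝ)
    else (transCount st act t s a s' : ℝ) / visits st act t s a
  p_nonneg := by
    intro s a s'
    split_ifs <;> positivity
  p_sum := by
    intro s a
    have : Nonempty S := ⟨s⟩
    by_cases h : visits st act t s a = 0
    · simp [h]
    · have h' : (visits st act t s a : ℝ) ≠ 0 := Nat.cast_ne_zero.2 h
      simp only [h, if_false]
      rw [← Finset.sum_div, ← Nat.cast_sum, sum_transCount, div_self h']
  r := fun s a =>
    (∑ k ∈ Finset.range t, if st k = s ∧ act k = a then rew k else 0) / visits st act t s a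
  γ := γ
  γ_nonneg := h0
  γ_lt_one := h1

end Empirical

/-- The two navigation rules. -/
inductive NavRule
  | cNavigation
  | dNavigation

/-- The policy played in round `t`, given the sequence `o` of oracle policies of the empirical
models: uniform in round `0`, and afterwards `ε_t π_u + (1 - ε_t) (1/t) ∑_{j=1}^t o_j`
(C-Navigation) or `ε_t π_u + (1 - ε_t) o_t` (D-Navigation). -/
def navPolicy {S A : Type*} [Fintype A] (rule : NavRule) (ε : ℕ → ℝ) (o : ℕ → S → A → ℝ)
    (t : ℕ) (s : S) (a : A) : ℝ :=
  if t = 0 then uniformPolicy S A s a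
  else ε t * uniformPolicy S A s a + (1 - ε t) *
    match rule with
    | .cNavigation => (∑ j ∈ Finset.Icc 1 t, o j s a) / t
    | .dNavigation => o t s a

/-- The process of states `st t`, actions `act t` and rewards `rew t` of a learner that plays the
policy `π t` in round `t` of the MDP `M`. The σ-algebra `ℱ t` contains the history up to the state
`st t`. Conditionally on it, the action has law `π t (st t)` and, given the action, the reward and
the next state are independent with laws `q(st t, act t)` and `p(· | st t, act t)`. -/
structure IsInteraction {S A Ω : Type*} [Fintype S] {mΩ : MeasurableSpace Ω} (M : MDP S A)
    (μ : Measure Ω) (ℱ : Filtration ℕ mΩ) (st : ℕ → Ω → S) (act : ℕ → Ω → A) (rew : ℕ → Ω → ℝ)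
    (π : ℕ → Ω → S → A → ℝ) : Prop where
  st_meas : ∀ t s, MeasurableSet[ℱ t] {x | st t x = s}
  act_meas : ∀ t a, MeasurableSet[ℱ (t + 1)] {x | act t x = a}
  rew_meas : ∀ t, Measurable[ℱ (t + 1)] (rew t)
  policy_meas : ∀ t s a, Measurable[ℱ t] fun x => π t x s a
  step : ∀ t a s' (B : Set ℝ), MeasurableSet B →
    μ[{x | act t x = a ∧ rew t x ∈ B ∧ st (t + 1) x = s'}.indicator (fun _ => (1 : ℝ)) | ℱ t]
      =ᵐ[μ] fun x => π t x (st t x) a * ((M.q (st t x) a).real B * M.p (st t x) a s')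

end NavMDP

end

set_option linter.unusedSectionVars false

/-! The proof separates a few almost sure limits from a deterministic argument along one trajectory.

Probability. Mixing in the uniform policy at rate `t ^ (-1 / (m + 1))` makes a given pair appear in
a block of `m + 1` rounds near time `t` with conditional probability at least a constant over `t`.
The harmonic series diverges, so the conditional Borel-Cantelli lemma gives infinitely many visits
(`ae_tendsto_visits`). A martingale law of large numbers at random observation times
(`ae_tendsto_sum_div_count`) then makes transition frequencies, mean rewards and action frequencies
consistent, and the empirical models converge to `M`.

Continuity of the oracle. Having a given policy as unique optimum amounts to finitely many strict
inequalities, so near `M` the optimal policy is frozen and `U` is jointly continuous in model and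
weights. The constraint set moves with the model, but the allocation that follows the policy of
`ωstar` in the approximating model is a competitor tending to `ωstar`. By compactness every limit of
oracle weights minimizes `M.U`, hence equals `ωstar` (`ConvergesTo.oracleWeights`). As `ωstar` is
positive, oracle policies converge too, and so do the played policies (`tendsto_navPolicy`).

Frequencies. No ergodic theorem for inhomogeneous chains is needed. The vectors `N(t) / t` lie in a
compact cube, satisfy the flow equations up to `o(1)` because entries to and exits from a state
differ by at most one, and follow the limit policy up to `o(1)`. Every limit point is therefore an
allocation following a full-support policy, and in a communicating model there is only one
(`allocation_unique`, `tendsto_visits_div`). -/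

noncomputable section

namespace NavMDP

namespace Model

/-! ### Bellman equations and characterization of the unique optimal policy. -/

section Planning

variable {S A : Type*} [Fintype S]

/-- One-step look-ahead value of the action `a` in the state `s`. -/
def lookahead (M : Model S A) (v : S → ℝ) (s : S) (a : A) : ℝ :=
  M.r s a + M.γ * ∑ s', M.p s a s' * v s'

/-- Minimum principle: at a minimizer the average of `d` is at least the minimum, so the minimum is
at least `γ` times itself, which forces it to be nonnegative since `γ < 1`. Applied to differences,
where rewards cancel, it compares policy values with sub- and supersolutions of the Bellman
equation. -/
theorem nonneg_of_discounted_superharmonic (M : Model S A) (π : S → A) (d : S → ℝ)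
    (h : ∀ s, M.γ * ∑ s', M.p s (π s) s' * d s' ≤ d s) (s : S) : 0 ≤ d s := by
  have : Nonempty S := ⟨s⟩
  obtain ⟨s₀, h₀⟩ := Finite.exists_min d
  have h1 : d s₀ ≤ ∑ s', M.p s₀ (π s₀) s' * d s' := by
    calc d s₀ = ∑ s', M.p s₀ (π s₀) s' * d s₀ := by rw [← Finset.sum_mul, M.p_sum, one_mul]
      _ ≤ _ := Finset.sum_le_sum fun s' _ => mul_le_mul_of_nonneg_left (h₀ s') (M.p_nonneg _ _ _)
  have h2 := h s₀
  have h3 := mul_le_mul_of_nonneg_left h1 M.γ_nonneg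
  have h4 : 0 ≤ (1 - M.γ) * d s₀ := by linarith
  have h5 : 0 ≤ d s₀ := by
    by_contra hc
    nlinarith [M.γ_lt_one]
  exact h5.trans (h₀ s)

variable [DecidableEq S]

theorem detKernel_pow_nonneg (M : Model S A) (π : S → A) (t : ℕ) (s s' : S) :
    0 ≤ (M.detKernel π ^ t) s s' := by
  induction t generalizing s with
  | zero => rw [pow_zero, Matrix.one_apply]; split_ifs <;> norm_num
  | succ t ih =>
    rw [pow_succ', Matrix.mul_apply]
    exact Finset.sum_nonneg fun j _ => mul_nonneg (M.p_nonneg _ _ _) (ih j)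

theorem detKernel_pow_sum (M : Model S A) (π : S → A) (t : ℕ) (s : S) :
    ∑ s', (M.detKernel π ^ t) s s' = 1 := by
  induction t generalizing s with
  | zero => simp [Matrix.one_apply]
  | succ t ih =>
    simp_rw [pow_succ', Matrix.mul_apply]
    rw [Finset.sum_comm]
    simp_rw [← Finset.mul_sum, ih, mul_one]
    exact M.p_sum _ _

theorem abs_value_term_le (M : Model S A) (π : S → A) {C : ℝ} (hC : ∀ s a, |M.r s a| ≤ C)
    (t : ℕ) (s : S) :
    |M.γ ^ t * ∑ s', (M.detKernel π ^ t) s s' * M.r s' (π s')| ≤ C * M.γ ^ t := by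
  rw [abs_mul, abs_of_nonneg (pow_nonneg M.γ_nonneg t), mul_comm]
  refine mul_le_mul_of_nonneg_right ?_ (pow_nonneg M.γ_nonneg t)
  calc _ ≤ ∑ s', |(M.detKernel π ^ t) s s' * M.r s' (π s')| := Finset.abs_sum_le_sum_abs _ _
    _ ≤ ∑ s', (M.detKernel π ^ t) s s' * C := by
        refine Finset.sum_le_sum fun s' _ => ?_
        rw [abs_mul, abs_of_nonneg (M.detKernel_pow_nonneg π t s s')]
        exact mul_le_mul_of_nonneg_left (hC _ _) (M.detKernel_pow_nonneg π t s s')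
    _ = C := by rw [← Finset.sum_mul, detKernel_pow_sum, one_mul]

variable [Fintype A]

theorem exists_reward_bound (M : Model S A) : ∃ C, ∀ s a, |M.r s a| ≤ C :=
  ⟨∑ s, ∑ a, |M.r s a|, fun s a =>
    (Finset.single_le_sum (f := fun a => |M.r s a|) (fun _ _ => abs_nonneg _)
      (Finset.mem_univ a)).trans
    (Finset.single_le_sum (f := fun s => ∑ a, |M.r s a|)
      (fun _ _ => Finset.sum_nonneg fun _ _ => abs_nonneg _) (Finset.mem_univ s))⟩

theorem summable_value (M : Model S A) (π : S → A) (s : S) :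
    Summable fun t : ℕ => M.γ ^ t * ∑ s', (M.detKernel π ^ t) s s' * M.r s' (π s') := by
  obtain ⟨C, hC⟩ := M.exists_reward_bound
  exact Summable.of_norm_bounded
    ((summable_geometric_of_lt_one M.γ_nonneg M.γ_lt_one).mul_left C)
    fun t => M.abs_value_term_le π hC t s

/-- The Bellman equation of a deterministic policy. -/
theorem value_eq_lookahead (M : Model S A) (π : S → A) (s : S) :
    M.value π s = M.lookahead (M.value π) s (π s) := by
  have h1 : ∀ t : ℕ, M.γ ^ (t + 1) * ∑ s', (M.detKernel π ^ (t + 1)) s s' * M.r s' (π s') =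
      ∑ s'', M.γ * (M.p s (π s) s'' *
        (M.γ ^ t * ∑ s', (M.detKernel π ^ t) s'' s' * M.r s' (π s'))) := by
    intro t
    simp_rw [pow_succ' (M.detKernel π), Matrix.mul_apply, Finset.sum_mul, Finset.mul_sum]
    rw [Finset.sum_comm]
    refine Finset.sum_congr rfl fun i _ => Finset.sum_congr rfl fun j _ => ?_
    simp only [detKernel, Matrix.of_apply]
    ring
  rw [value, (M.summable_value π s).tsum_eq_zero_add]
  simp_rw [h1]
  rw [Summable.tsum_finsetSum fun i _ => ((M.summable_value π i).mul_left _).mul_left _]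
  simp_rw [tsum_mul_left]
  simp [lookahead, value, Matrix.one_apply, Finset.mul_sum]

theorem value_le_of_lookahead_le (M : Model S A) (π : S → A) (v : S → ℝ)
    (h : ∀ s, M.lookahead v s (π s) ≤ v s) (s : S) : M.value π s ≤ v s := by
  have := M.nonneg_of_discounted_superharmonic π (fun s => v s - M.value π s) (fun s => ?_) s
  · exact sub_nonneg.1 this
  · have h1 := h s
    have h2 := M.value_eq_lookahead π s
    simp only [lookahead] at h1 h2
    simp only [mul_sub, Finset.sum_sub_distrib]
    linarith

theorem le_value_of_le_lookahead (M : Model S A) (π : S → A) (v : S → ℝ)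
    (h : ∀ s, v s ≤ M.lookahead v s (π s)) (s : S) : v s ≤ M.value π s := by
  have := M.nonneg_of_discounted_superharmonic π (fun s => M.value π s - v s) (fun s => ?_) s
  · exact sub_nonneg.1 this
  · have h1 := h s
    have h2 := M.value_eq_lookahead π s
    simp only [lookahead] at h1 h2
    simp only [mul_sub, Finset.sum_sub_distrib]
    linarith

theorem value_le_V (M : Model S A) (π : S → A) (s : S) : M.value π s ≤ M.V s :=
  le_ciSup (f := fun π => M.value π s) (Set.finite_range _).bddAbove π

/-- A unique optimal policy has positive gaps at all other actions. -/
theorem gap_pos_of_unique (M : Model S A) {π : S → A} (hπ : M.IsOptimalPolicy π)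
    (hu : ∀ π', M.IsOptimalPolicy π' → π' = π) (s : S) (a : A) (ha : a ≠ π s) :
    0 < M.gap s a := by
  by_contra hc
  have hV : M.value π = M.V := funext hπ
  have hQ : M.V s ≤ M.lookahead M.V s a := by
    have : M.V s - M.lookahead M.V s a ≤ 0 := not_lt.1 hc
    linarith
  -- If the gap is not positive, switching to `a` at `s` alone loses nothing, so the modified policy
  -- is optimal as well.
  have hle : ∀ s', M.V s' ≤ M.value (Function.update π s a) s' := by
    refine M.le_value_of_le_lookahead _ _ fun s' => ?_
    by_cases h : s' = s
    · subst h; simpa using hQ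
    · rw [Function.update_of_ne h, ← hV, ← M.value_eq_lookahead]
  have := hu _ fun s' => le_antisymm (M.value_le_V _ _) (hle s')
  exact ha (by rw [← this]; simp)

/-- A policy whose strict one-step deviations lose value is the unique optimal policy. -/
theorem optimal_unique_of_lookahead_lt [Nonempty A] (M : Model S A) {π : S → A}
    (h : ∀ s a, a ≠ π s → M.lookahead (M.value π) s a < M.value π s) :
    M.IsOptimalPolicy π ∧ ∀ π', M.IsOptimalPolicy π' → π' = π := by
  have h' : ∀ s a, M.lookahead (M.value π) s a ≤ M.value π s := fun s a => by
    by_cases ha : a = π s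
    · rw [ha, ← value_eq_lookahead]
    · exact (h s a ha).le
  have hopt : M.IsOptimalPolicy π := fun s => le_antisymm (M.value_le_V _ _)
    (ciSup_le fun π' => M.value_le_of_lookahead_le π' _ (fun s => h' s _) s)
  refine ⟨hopt, fun π' hπ' => funext fun s => by_contra fun hne => ?_⟩
  have h1 := h s _ hne
  -- Two optimal policies share their value, so the Bellman equation of `π'` at `s` contradicts the
  -- strict inequality there.
  have h2 : M.value π' = M.value π := funext fun s => (hπ' s).trans (hopt s).symm
  rw [← h2, ← value_eq_lookahead] at h1
  exact lt_irrefl _ h1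

theorem optPolicy_spec [Nonempty A] (M : Model S A) (h : M.Admissible) :
    M.IsOptimalPolicy M.optPolicy ∧ ∀ π', M.IsOptimalPolicy π' → π' = M.optPolicy := by
  obtain ⟨π, h1, h2⟩ := h.2
  have : M.IsOptimalPolicy M.optPolicy := Classical.epsilon_spec ⟨π, h1⟩
  exact ⟨this, fun π' h' => (h2 π' h').trans (h2 _ this).symm⟩

theorem gap_pos [Nonempty A] (M : Model S A) (h : M.Admissible) (s : S) (a : A)
    (ha : a ≠ M.optPolicy s) : 0 < M.gap s a :=
  M.gap_pos_of_unique (M.optPolicy_spec h).1 (M.optPolicy_spec h).2 s a ha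

end Planning

/-! ### Continuity of values and stability of the optimal policy under convergence of models. -/

section Convergence

variable {ι S A : Type*} [Fintype S]

/-- Convergence of models with a common discount factor. -/
structure ConvergesTo (Mt : ι → Model S A) (l : Filter ι) (M : Model S A) : Prop where
  γ_eq : ∀ i, (Mt i).γ = M.γ
  p : ∀ s a s', Tendsto (fun i => (Mt i).p s a s') l (𝓝 (M.p s a s'))
  r : ∀ s a, Tendsto (fun i => (Mt i).r s a) l (𝓝 (M.r s a))

namespace ConvergesTo

variable {Mt : ι → Model S A} {l : Filter ι} {M : Model S A}

theorem mono {l' : Filter ι} (h : ConvergesTo Mt l M) (hl : l' ≤ l) : ConvergesTo Mt l' M :=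
  ⟨h.γ_eq, fun s a s' => (h.p s a s').mono_left hl, fun s a => (h.r s a).mono_left hl⟩

theorem lookahead (h : ConvergesTo Mt l M) {v : ι → S → ℝ} {v₀ : S → ℝ}
    (hv : ∀ s, Tendsto (fun i => v i s) l (𝓝 (v₀ s))) (s : S) (a : A) :
    Tendsto (fun i => (Mt i).lookahead (v i) s a) l (𝓝 (M.lookahead v₀ s a)) := by
  unfold Model.lookahead
  simp_rw [h.γ_eq]
  exact (h.r s a).add ((tendsto_finsetSum _ fun s' _ => (h.p s a s').mul (hv s')).const_mul _)

variable [DecidableEq S]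

theorem detKernel_pow (h : ConvergesTo Mt l M) (π : S → A) (t : ℕ) (s s' : S) :
    Tendsto (fun i => ((Mt i).detKernel π ^ t) s s') l (𝓝 ((M.detKernel π ^ t) s s')) := by
  induction t generalizing s with
  | zero => simpa using tendsto_const_nhds
  | succ t ih =>
    simp_rw [pow_succ', Matrix.mul_apply]
    exact tendsto_finsetSum _ fun j _ => (h.p _ _ _).mul (ih j)

theorem communicating (h : ConvergesTo Mt l M) (hM : M.Communicating) :
    ∀ᶠ i in l, (Mt i).Communicating := by
  unfold Communicating
  simp_rw [eventually_all]
  intro s s'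
  obtain ⟨n, hn, π, hπ⟩ := hM s s'
  filter_upwards [(h.detKernel_pow π n s s').eventually_const_lt hπ] with i hi
  exact ⟨n, hn, π, hi⟩

variable [Fintype A]

theorem value (h : ConvergesTo Mt l M) (π : S → A) (s : S) :
    Tendsto (fun i => (Mt i).value π s) l (𝓝 (M.value π s)) := by
  obtain ⟨C, hC⟩ := M.exists_reward_bound
  -- Since the rewards converge, the single bound `C + 1` eventually serves all models, as dominated
  -- convergence requires.
  have hb : ∀ᶠ i in l, ∀ s a, |(Mt i).r s a| ≤ C + 1 := by
    simp_rw [eventually_all]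
    intro s a
    filter_upwards [(h.r s a).abs.eventually_lt_const
      (lt_of_le_of_lt (hC s a) (lt_add_one C))] with i hi using hi.le
  unfold Model.value
  simp_rw [h.γ_eq]
  refine tendsto_tsum_of_dominated_convergence (bound := fun t => (C + 1) * M.γ ^ t)
    ((summable_geometric_of_lt_one M.γ_nonneg M.γ_lt_one).mul_left _) (fun t => ?_) ?_
  · exact (tendsto_finsetSum _ fun s' _ => (h.detKernel_pow π t s s').mul (h.r _ _)).const_mul _
  · filter_upwards [hb] with i hi t
    rw [← h.γ_eq i]
    exact (Mt i).abs_value_term_le π hi t s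

variable [Nonempty A]

/-- Unique optimality of `M.optPolicy` follows from strict inequalities involving only the value of
that fixed policy. These are finitely many, continuous in the model, and hold at `M` because the
gaps are positive. -/
theorem eventually_optimal (h : ConvergesTo Mt l M) (hM : M.Admissible) :
    ∀ᶠ i in l, (Mt i).Admissible ∧ (Mt i).optPolicy = M.optPolicy := by
  have h1 : ∀ᶠ i in l, ∀ s a, a ≠ M.optPolicy s →
      (Mt i).lookahead ((Mt i).value M.optPolicy) s a < (Mt i).value M.optPolicy s := by
    simp_rw [eventually_all]
    intro s a ha
    refine (h.lookahead (h.value M.optPolicy) s a).eventually_lt (h.value M.optPolicy s) ?_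
    have := M.gap_pos hM s a ha
    have hV : M.value M.optPolicy = M.V := funext (M.optPolicy_spec hM).1
    rw [hV]
    exact sub_pos.1 this
  filter_upwards [h1, h.communicating hM.1] with i hi hc
  obtain ⟨h2, h3⟩ := (Mt i).optimal_unique_of_lookahead_lt hi
  have ha : (Mt i).Admissible := ⟨hc, _, h2, h3⟩
  exact ⟨ha, h3 _ ((Mt i).optPolicy_spec ha).1⟩

/-- Eventually `V` is the value of the fixed policy `M.optPolicy`, so the supremum over policies
disappears. -/
theorem V (h : ConvergesTo Mt l M) (hM : M.Admissible) (s : S) :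
    Tendsto (fun i => (Mt i).V s) l (𝓝 (M.V s)) := by
  rw [← (M.optPolicy_spec hM).1 s]
  refine (h.value M.optPolicy s).congr' ?_
  filter_upwards [h.eventually_optimal hM] with i hi
  rw [← hi.2]
  exact ((Mt i).optPolicy_spec hi.1).1 s

theorem gap (h : ConvergesTo Mt l M) (hM : M.Admissible) (s : S) (a : A) :
    Tendsto (fun i => (Mt i).gap s a) l (𝓝 (M.gap s a)) :=
  (h.V hM s).sub (h.lookahead (h.V hM) s a)

end ConvergesTo

end Convergence

end Model

/-! ### Stationary vectors of finite stochastic matrices. -/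

section Stationary

variable {S : Type*} [Fintype S]

/-- The triangle inequality gives `|d| ≤ |d| P` coordinatewise. Both sides have the same total
because `P` is stochastic, so equality holds in every coordinate. -/
theorem abs_stationary {P : S → S → ℝ} (h0 : ∀ s s', 0 ≤ P s s') (h1 : ∀ s, ∑ s', P s s' = 1)
    {d : S → ℝ} (hd : ∀ s', ∑ s, d s * P s s' = d s') (s' : S) :
    ∑ s, |d s| * P s s' = |d s'| := by
  have hle : ∀ s' ∈ Finset.univ, |d s'| ≤ ∑ s, |d s| * P s s' := fun s' _ => by
    rw [← hd s']
    refine (Finset.abs_sum_le_sum_abs _ _).trans_eq (Finset.sum_congr rfl fun s _ => ?_)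
    rw [abs_mul, abs_of_nonneg (h0 s s')]
  have hsum : ∑ s', |d s'| = ∑ s', ∑ s, |d s| * P s s' := by
    rw [Finset.sum_comm]
    simp_rw [← Finset.mul_sum, h1, mul_one]
  exact ((Finset.sum_eq_sum_iff_of_le hle).1 hsum s' (Finset.mem_univ _)).symm

/-- `1 - P` kills the constant vector, so it is singular and also has a nonzero left null vector;
the normalized absolute value of that vector is stationary. -/
theorem exists_stationary [DecidableEq S] [Nonempty S] {P : S → S → ℝ} (h0 : ∀ s s', 0 ≤ P s s')
    (h1 : ∀ s, ∑ s', P s s' = 1) :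
    ∃ u : S → ℝ, (∀ s, 0 ≤ u s) ∧ ∑ s, u s = 1 ∧ ∀ s', ∑ s, u s * P s s' = u s' := by
  have hdet : (1 - Matrix.of P).det = 0 := by
    rw [← Matrix.exists_mulVec_eq_zero_iff]
    refine ⟨fun _ => 1, fun h => one_ne_zero (congrFun h (Classical.arbitrary S)), ?_⟩
    ext s
    simp [Matrix.mulVec, dotProduct, h1, Matrix.one_apply]
  obtain ⟨d, hd0, hd⟩ := Matrix.exists_vecMul_eq_zero_iff.2 hdet
  have hd' : ∀ s', ∑ s, d s * P s s' = d s' := fun s' => by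
    have := congrFun hd s'
    rw [Matrix.vecMul_sub, Matrix.vecMul_one] at this
    simp only [Pi.sub_apply, Matrix.vecMul, dotProduct, Matrix.of_apply, Pi.zero_apply] at this
    linarith
  have hpos : 0 < ∑ s, |d s| := by
    obtain ⟨s, hs⟩ := Function.ne_iff.1 hd0
    exact Finset.sum_pos' (fun _ _ => abs_nonneg _) ⟨s, Finset.mem_univ _, abs_pos.2 hs⟩
  refine ⟨fun s => |d s| / ∑ s, |d s|, fun s => by positivity, ?_, fun s' => ?_⟩
  · rw [← Finset.sum_div, div_self hpos.ne']
  · simp_rw [div_mul_eq_mul_div]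
    rw [← Finset.sum_div, abs_stationary h0 h1 hd']

/-- Irreducibility enters as `hirr`. If the difference `d` were positive somewhere, the nonnegative
stationary vector `|d| + d` would be positive everywhere, hence so would `d`, against its zero sum.
So `d ≤ 0` with zero sum. -/
theorem stationary_unique {P : S → S → ℝ} (h0 : ∀ s s', 0 ≤ P s s')
    (h1 : ∀ s, ∑ s', P s s' = 1)
    (hirr : ∀ u : S → ℝ, (∀ s, 0 ≤ u s) → (∀ s', ∑ s, u s * P s s' = u s') →
      ∀ s s', 0 < u s → 0 < u s')
    {x y : S → ℝ} (hx : ∀ s', ∑ s, x s * P s s' = x s') (hy : ∀ s', ∑ s, y s * P s s' = y s')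
    (hxy : ∑ s, x s = ∑ s, y s) : x = y := by
  set d : S → ℝ := fun s => x s - y s with hd
  have hds : ∀ s', ∑ s, d s * P s s' = d s' := fun s' => by
    simp only [hd, sub_mul, Finset.sum_sub_distrib, hx, hy]
  have hsum : ∑ s, d s = 0 := by simp [hd, hxy]
  have hle : ∀ s, d s ≤ 0 := by
    intro s
    by_contra hc
    have hc : 0 < d s := not_le.1 hc
    have hpos : ∀ s', 0 < d s' := by
      intro s'
      have := hirr (fun s => |d s| + d s) (fun s => by linarith [neg_abs_le (d s)])
        (fun s' => by simp only [add_mul, Finset.sum_add_distrib, abs_stationary h0 h1 hds, hds])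
        s s' (by positivity)
      by_contra hn
      rw [abs_of_nonpos (not_lt.1 hn)] at this
      linarith
    have := Finset.sum_pos (s := Finset.univ) (fun s' _ => hpos s') ⟨s, Finset.mem_univ _⟩
    linarith
  funext s
  have := (Finset.sum_eq_zero_iff_of_nonpos (fun s _ => hle s)).1 hsum s (Finset.mem_univ _)
  exact sub_eq_zero.1 this

end Stationary

namespace Model

/-! ### Allocations as stationary distributions of randomized policies. -/

section Allocations

variable {S A : Type*} [Fintype S] [Fintype A]

/-- Transition probabilities on states under a stationary randomized policy. -/
def stateKernel (M : Model S A) (ψ : S → A → ℝ) (s s' : S) : ℝ := ∑ a, ψ s a * M.p s a s'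

theorem stateKernel_nonneg (M : Model S A) {ψ : S → A → ℝ} (hψ : IsPolicy ψ) (s s' : S) :
    0 ≤ M.stateKernel ψ s s' :=
  Finset.sum_nonneg fun a _ => mul_nonneg ((hψ s).1 a) (M.p_nonneg _ _ _)

theorem stateKernel_sum (M : Model S A) {ψ : S → A → ℝ} (hψ : IsPolicy ψ) (s : S) :
    ∑ s', M.stateKernel ψ s s' = 1 := by
  unfold stateKernel
  rw [Finset.sum_comm]
  simp_rw [← Finset.mul_sum, M.p_sum, mul_one]
  exact (hψ s).2

/-- Mass propagates along a path of the deterministic policy given by communication, since `ψ` takes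
each action of that path with positive probability. -/
theorem stationary_pos [DecidableEq S] (M : Model S A) (hM : M.Communicating) {ψ : S → A → ℝ}
    (hψ : ∀ s a, 0 < ψ s a) (u : S → ℝ) (hu : ∀ s, 0 ≤ u s)
    (hst : ∀ s', ∑ s, u s * M.stateKernel ψ s s' = u s') (s s' : S) (hs : 0 < u s) :
    0 < u s' := by
  obtain ⟨n, -, π, hn⟩ := hM s s'
  induction n generalizing s with
  | zero =>
    rw [pow_zero, Matrix.one_apply] at hn
    split_ifs at hn with h
    · exact h ▸ hs
    · exact absurd hn (lt_irrefl _)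
  | succ n ih =>
    rw [pow_succ', Matrix.mul_apply] at hn
    obtain ⟨j, -, hj⟩ := Finset.exists_lt_of_sum_lt
      (f := fun _ : S => (0 : ℝ)) (s := Finset.univ) (by simpa using hn)
    have hp : 0 < M.p s (π s) j := lt_of_le_of_ne (M.p_nonneg _ _ _) fun h => by
      simp [detKernel, ← h] at hj
    have hq : 0 < (M.detKernel π ^ n) j s' := lt_of_le_of_ne
      (M.detKernel_pow_nonneg _ _ _ _) fun h => by simp [← h] at hj
    have hK : ∀ s s', 0 ≤ M.stateKernel ψ s s' := fun s s' =>
      Finset.sum_nonneg fun a _ => mul_nonneg (hψ s a).le (M.p_nonneg _ _ _)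
    have hK' : 0 < M.stateKernel ψ s j :=
      Finset.sum_pos' (fun a _ => mul_nonneg (hψ s a).le (M.p_nonneg _ _ _))
        ⟨π s, Finset.mem_univ _, mul_pos (hψ _ _) hp⟩
    refine ih j ?_ hq
    rw [← hst j]
    exact Finset.sum_pos' (fun s _ => mul_nonneg (hu s) (hK _ _))
      ⟨s, Finset.mem_univ _, mul_pos hs hK'⟩

/-- With `stationary_of_allocation`, this is the dictionary between allocations following `ψ` and
stationary distributions of the state chain under `ψ`. -/
theorem allocation_of_stationary (M : Model S A) {ψ : S → A → ℝ} (hψ : IsPolicy ψ) {u : S → ℝ}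
    (hu : ∀ s, 0 ≤ u s) (h1 : ∑ s, u s = 1)
    (hst : ∀ s', ∑ s, u s * M.stateKernel ψ s s' = u s') :
    (fun s a => ψ s a * u s) ∈ M.Allocations := by
  refine ⟨fun s a => mul_nonneg ((hψ s).1 a) (hu s), ?_, fun s => ?_⟩
  · simp_rw [← Finset.sum_mul, (hψ _).2, one_mul, h1]
  · simp_rw [← Finset.sum_mul, (hψ _).2, one_mul]
    rw [← hst s]
    refine Finset.sum_congr rfl fun s' _ => ?_
    rw [stateKernel, Finset.mul_sum]
    exact Finset.sum_congr rfl fun a _ => by ring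

theorem stationary_of_allocation (M : Model S A) {ψ ω : S → A → ℝ} (hω : ω ∈ M.Allocations)
    (h : ∀ s a, ω s a = ψ s a * ∑ b, ω s b) (s' : S) :
    ∑ s, (∑ b, ω s b) * M.stateKernel ψ s s' = ∑ b, ω s' b := by
  rw [hω.2.2 s']
  refine Finset.sum_congr rfl fun s _ => ?_
  rw [stateKernel, Finset.mul_sum]
  refine Finset.sum_congr rfl fun a _ => ?_
  rw [h s a]; ring

/-- Valid in every model, communicating or not, which provides competitors in all approximating
models. -/
theorem exists_allocation [DecidableEq S] [Nonempty S] (M : Model S A) {ψ : S → A → ℝ}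
    (hψ : IsPolicy ψ) : ∃ ω ∈ M.Allocations, ∀ s a, ω s a = ψ s a * ∑ b, ω s b := by
  obtain ⟨u, hu, h1, hst⟩ := exists_stationary (M.stateKernel_nonneg hψ) (M.stateKernel_sum hψ)
  refine ⟨_, M.allocation_of_stationary hψ hu h1 hst, fun s a => ?_⟩
  simp_rw [← Finset.sum_mul, (hψ _).2, one_mul]

theorem allocation_unique [DecidableEq S] (M : Model S A) (hM : M.Communicating) {ψ : S → A → ℝ}
    (hψ : IsPolicy ψ) (hpos : ∀ s a, 0 < ψ s a) {ω ω' : S → A → ℝ} (hω : ω ∈ M.Allocations)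
    (h : ∀ s a, ω s a = ψ s a * ∑ b, ω s b) (hω' : ω' ∈ M.Allocations)
    (h' : ∀ s a, ω' s a = ψ s a * ∑ b, ω' s b) : ω = ω' := by
  have := stationary_unique (M.stateKernel_nonneg hψ) (M.stateKernel_sum hψ)
    (M.stationary_pos hM hpos) (M.stationary_of_allocation hω h)
    (M.stationary_of_allocation hω' h') (hω.2.1.trans hω'.2.1.symm)
  funext s a
  rw [h, h', congrFun this s]

theorem sum_allocation_pos [DecidableEq S] (M : Model S A) (hM : M.Communicating) {ψ : S → A → ℝ}
    (hpos : ∀ s a, 0 < ψ s a) {ω : S → A → ℝ} (hω : ω ∈ M.Allocations)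
    (h : ∀ s a, ω s a = ψ s a * ∑ b, ω s b) (s : S) : 0 < ∑ b, ω s b := by
  have h0 : ∀ s, 0 ≤ ∑ b, ω s b := fun s => Finset.sum_nonneg fun b _ => hω.1 s b
  obtain ⟨s₀, -, hs₀⟩ := Finset.exists_lt_of_sum_lt (f := fun _ : S => (0 : ℝ))
    (s := Finset.univ) (g := fun s => ∑ b, ω s b) (by rw [hω.2.1]; simp)
  exact M.stationary_pos hM hpos _ h0 (M.stationary_of_allocation hω h) s₀ s hs₀

theorem allocation_pos [DecidableEq S] (M : Model S A) (hM : M.Communicating) {ψ : S → A → ℝ}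
    (hpos : ∀ s a, 0 < ψ s a) {ω : S → A → ℝ} (hω : ω ∈ M.Allocations)
    (h : ∀ s a, ω s a = ψ s a * ∑ b, ω s b) (s : S) (a : A) : 0 < ω s a := by
  rw [h]
  exact mul_pos (hpos _ _) (M.sum_allocation_pos hM hpos hω h s)

/-- Asymptotically balanced weights that asymptotically follow a full-support policy converge to
the stationary allocation of that policy. -/
theorem tendsto_allocation [DecidableEq S] {ι : Type*} {l : Filter ι} (M : Model S A)
    (hM : M.Communicating) {ψ : S → A → ℝ} (hψ : IsPolicy ψ) (hpos : ∀ s a, 0 < ψ s a)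
    {ω : S → A → ℝ} (hω : ω ∈ M.Allocations) (h : ∀ s a, ω s a = ψ s a * ∑ b, ω s b)
    {x : ι → S → A → ℝ} (hx : ∀ᶠ i in l, x i ∈ Set.Icc (0 : S → A → ℝ) 1)
    (hsum : Tendsto (fun i => ∑ s, ∑ a, x i s a) l (𝓝 1))
    (hflow : ∀ s, Tendsto (fun i => ∑ a, x i s a - ∑ s', ∑ a', M.p s' a' s * x i s' a') l (𝓝 0))
    (hpol : ∀ s a, Tendsto (fun i => x i s a - ψ s a * ∑ b, x i s b) l (𝓝 0)) :
    Tendsto x l (𝓝 ω) := by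
  -- Along an ultrafilter the bounded family has a limit; the three asymptotic identities become
  -- exact for it, and uniqueness identifies it with `ω`.
  rw [tendsto_iff_ultrafilter]
  intro g hg
  obtain ⟨y, -, hy⟩ := (isCompact_Icc (a := (0 : S → A → ℝ)) (b := 1)).ultrafilter_le_nhds'
    (g.map x) (hg hx)
  have hy : Tendsto x g (𝓝 y) := hy
  have hxy : ∀ s a, Tendsto (fun i => x i s a) g (𝓝 (y s a)) := fun s a =>
    tendsto_pi_nhds.1 (tendsto_pi_nhds.1 hy s) a
  have hys : y ∈ M.Allocations := by
    refine ⟨fun s a => ge_of_tendsto (hxy s a) ?_, ?_, fun s => ?_⟩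
    · filter_upwards [hg hx] with i hi using hi.1 s a
    · exact tendsto_nhds_unique
        (tendsto_finsetSum _ fun s _ => tendsto_finsetSum _ fun a _ => hxy s a) (hsum.mono_left hg)
    · exact sub_eq_zero.1 <| tendsto_nhds_unique
        ((tendsto_finsetSum _ fun a _ => hxy s a).sub
          (tendsto_finsetSum _ fun s' _ => tendsto_finsetSum _ fun a' _ =>
            (hxy s' a').const_mul _)) ((hflow s).mono_left hg)
  have hyp : ∀ s a, y s a = ψ s a * ∑ b, y s b := fun s a =>
    sub_eq_zero.1 <| tendsto_nhds_unique ((hxy s a).sub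
      ((tendsto_finsetSum _ fun b _ => hxy s b).const_mul _)) ((hpol s a).mono_left hg)
  rw [M.allocation_unique hM hψ hpos hω h hys hyp]
  exact hy

theorem allocation_mem_Icc (M : Model S A) {ω : S → A → ℝ} (hω : ω ∈ M.Allocations) :
    ω ∈ Set.Icc (0 : S → A → ℝ) 1 := by
  refine ⟨fun s a => hω.1 s a, fun s a => ?_⟩
  show ω s a ≤ 1
  rw [← hω.2.1]
  exact (Finset.single_le_sum (f := fun a => ω s a) (fun a _ => hω.1 s a)
    (Finset.mem_univ a)).trans (Finset.single_le_sum (f := fun s => ∑ a, ω s a)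
      (fun s _ => Finset.sum_nonneg fun a _ => hω.1 s a) (Finset.mem_univ s))

/-- The policy with which weights are visited. -/
def policyOf (ω : S → A → ℝ) (s : S) (a : A) : ℝ := ω s a / ∑ b, ω s b

theorem isPolicy_policyOf [Nonempty A] {ω : S → A → ℝ} (hω : ∀ s a, 0 < ω s a) :
    IsPolicy (policyOf ω) := fun s => by
  have : 0 < ∑ b, ω s b := Finset.sum_pos (fun b _ => hω s b) Finset.univ_nonempty
  refine ⟨fun a => div_nonneg (hω s a).le this.le, ?_⟩
  unfold policyOf
  rw [← Finset.sum_div, div_self this.ne']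

theorem policyOf_pos [Nonempty A] {ω : S → A → ℝ} (hω : ∀ s a, 0 < ω s a) (s : S) (a : A) :
    0 < policyOf ω s a :=
  div_pos (hω s a) (Finset.sum_pos (fun b _ => hω s b) Finset.univ_nonempty)

theorem policyOf_mul_sum [Nonempty A] {ω : S → A → ℝ} (hω : ∀ s a, 0 < ω s a) (s : S) (a : A) :
    ω s a = policyOf ω s a * ∑ b, ω s b :=
  (div_mul_cancel₀ _ (Finset.sum_pos (fun b _ => hω s b) Finset.univ_nonempty).ne').symm

end Allocations

end Model

theorem tendsto_iSup_of_finite {ι κ L : Type*} [Finite κ] [Nonempty κ]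
    [ConditionallyCompleteLinearOrder L] [TopologicalSpace L] [OrderTopology L] {l : Filter ι}
    {f : ι → κ → L} {g : κ → L} (h : ∀ k, Tendsto (fun i => f i k) l (𝓝 (g k))) :
    Tendsto (fun i => ⨆ k, f i k) l (𝓝 (⨆ k, g k)) := by
  cases nonempty_fintype κ
  simp_rw [← Finset.sup'_univ_eq_ciSup]
  exact Tendsto.finset_sup'_nhds_apply _ fun k _ => h k

theorem tendsto_iInf_of_finite {ι κ L : Type*} [Finite κ] [Nonempty κ]
    [ConditionallyCompleteLinearOrder L] [TopologicalSpace L] [OrderTopology L] {l : Filter ι}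
    {f : ι → κ → L} {g : κ → L} (h : ∀ k, Tendsto (fun i => f i k) l (𝓝 (g k))) :
    Tendsto (fun i => ⨅ k, f i k) l (𝓝 (⨅ k, g k)) := by
  cases nonempty_fintype κ
  simp_rw [← Finset.inf'_univ_eq_ciInf]
  exact Tendsto.finset_inf'_nhds_apply _ fun k _ => h k

namespace Model

/-! ### Finiteness of the characteristic time and positivity of oracle weights. -/

section Characteristic

variable {S A : Type*} [Fintype S] [DecidableEq S] [Fintype A] [DecidableEq A] [Nonempty A]

theorem varV_nonneg (M : Model S A) (s : S) (a : A) : 0 ≤ M.varV s a :=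
  Finset.sum_nonneg fun _ _ => mul_nonneg (M.p_nonneg _ _ _) (sq_nonneg _)

theorem varMax_nonneg (M : Model S A) : 0 ≤ M.varMax :=
  Real.iSup_nonneg fun _ => M.varV_nonneg _ _

theorem H_pos (M : Model S A) {s : S} {a : A} (h : 0 < M.gap s a) : 0 < M.H s a := by
  have := M.varV_nonneg s a
  exact add_pos_of_pos_of_nonneg (by positivity) (le_max_of_le_left (by positivity))

theorem nonempty_nonoptimal [Nontrivial A] (π : S → A) [Nonempty S] :
    Nonempty {z : S × A // z.2 ≠ π z.1} := by
  obtain ⟨a, ha⟩ := exists_ne (π (Classical.arbitrary S))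
  exact ⟨⟨(Classical.arbitrary S, a), ha⟩⟩

theorem gapMin_pos [Nontrivial A] [Nonempty S] (M : Model S A) (hM : M.Admissible) :
    0 < M.gapMin := by
  have := nonempty_nonoptimal M.optPolicy
  obtain ⟨z, hz⟩ := exists_eq_ciInf_of_finite
    (f := fun z : {z : S × A // z.2 ≠ M.optPolicy z.1} => M.gap z.1.1 z.1.2)
  rw [gapMin, ← hz]
  exact M.gap_pos hM _ _ z.2

theorem Hstar_pos [Nontrivial A] [Nonempty S] (M : Model S A) (hM : M.Admissible) :
    0 < M.Hstar := by
  have hg := M.gapMin_pos hM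
  have hγ : 0 < 1 - M.γ := sub_pos.2 M.γ_lt_one
  have hv := M.varMax_nonneg
  have h3 : 0 < M.T3 := by unfold T3; positivity
  have h4 : 0 ≤ M.T4 := le_min (by positivity) (le_max_of_le_left (by positivity))
  have hS : (0 : ℝ) < Fintype.card S := by exact_mod_cast Fintype.card_pos
  exact mul_pos hS (by linarith)

theorem U_eq_zero_of_subsingleton [Subsingleton A] (M : Model S A) (ω : S → A → ℝ) :
    M.U ω = 0 := by
  have : IsEmpty {z : S × A // z.2 ≠ M.optPolicy z.1} :=
    ⟨fun z => z.2 (Subsingleton.elim _ _)⟩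
  -- A real infimum over an empty type is `0`, and division by zero then makes `T3` and `T4` vanish.
  have h : M.gapMin = 0 := Real.iInf_of_isEmpty _
  simp [U, Hstar, T3, T4, h]

theorem U_lt_top [Nonempty S] (M : Model S A) {ω : S → A → ℝ} (hω : ∀ s a, 0 < ω s a) :
    M.U ω < ⊤ := by
  have hS : (0 : ℝ) < Fintype.card S := by exact_mod_cast Fintype.card_pos
  refine ENNReal.add_lt_top.2 ⟨?_, ENNReal.div_lt_top ENNReal.ofReal_ne_top ?_⟩
  · rw [← Finset.sup_univ_eq_iSup, Finset.sup_lt_iff ENNReal.zero_lt_top]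
    exact fun z _ => ENNReal.div_lt_top ENNReal.ofReal_ne_top (by simpa using hω _ _)
  · obtain ⟨s, hs⟩ := exists_eq_ciInf_of_finite (f := fun s => ω s (M.optPolicy s))
    rw [← hs]
    exact (ENNReal.ofReal_pos.2 (mul_pos hS (hω _ _))).ne'

/-- Positivity of the numerator matters: in `ENNReal`, `0 / 0 = 0`. This is why `H` and `Hstar` are
shown to be positive. -/
theorem ofReal_div_ofReal_eq_top {a b : ℝ} (ha : 0 < a) (hb : b ≤ 0) :
    ENNReal.ofReal a / ENNReal.ofReal b = ⊤ := by
  rw [ENNReal.ofReal_of_nonpos hb, ENNReal.div_zero]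
  simpa using ha

theorem isPolicy_uniformPolicy : IsPolicy (uniformPolicy S A) := fun s => by
  refine ⟨fun a => by unfold uniformPolicy; positivity, ?_⟩
  simp [uniformPolicy]

theorem uniformPolicy_pos (s : S) (a : A) : 0 < uniformPolicy S A s a := by
  have : (0 : ℝ) < Fintype.card A := by exact_mod_cast Fintype.card_pos
  exact one_div_pos.2 this

/-- Oracle weights of an admissible model are positive. -/
theorem oracleWeights_pos (M : Model S A) (hM : M.Admissible) {ω : S → A → ℝ}
    (hω : M.IsOracleWeights ω) (s : S) (a : A) : 0 < ω s a := by
  have : Nonempty S := ⟨s⟩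
  obtain hA | hA := subsingleton_or_nontrivial A
  -- With a single action `U` vanishes and minimality says nothing; positivity comes from
  -- irreducibility of the only available chain.
  · refine M.allocation_pos hM.1 (ψ := fun _ _ => 1) (fun _ _ => one_pos) hω.1 (fun s a => ?_) s a
    rw [Fintype.sum_subsingleton _ a, one_mul]
  -- The allocation of the uniform policy has finite `U`, hence so do oracle weights, whereas a
  -- vanishing weight would make `U` infinite.
  · obtain ⟨w, hw, hwp⟩ := M.exists_allocation isPolicy_uniformPolicy
    have hU : M.U ω < ⊤ := (hω.2 w hw).trans_lt
      (M.U_lt_top (M.allocation_pos hM.1 uniformPolicy_pos hw hwp))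
    obtain ⟨h1, h2⟩ := ENNReal.add_lt_top.1 hU
    by_contra hc
    have hc : ω s a ≤ 0 := not_lt.1 hc
    by_cases ha : a = M.optPolicy s
    · refine h2.ne (ofReal_div_ofReal_eq_top (M.Hstar_pos hM) ?_)
      refine mul_nonpos_of_nonneg_of_nonpos (Nat.cast_nonneg _) ?_
      exact (ciInf_le (f := fun s => ω s (M.optPolicy s)) (Set.finite_range _).bddBelow s).trans
        (ha ▸ hc)
    · refine (h1.trans_le' (le_iSup (fun z : {z : S × A // z.2 ≠ M.optPolicy z.1} =>
        ENNReal.ofReal (M.H z.1.1 z.1.2) / ENNReal.ofReal (ω z.1.1 z.1.2)) ⟨(s, a), ha⟩)).ne ?_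
      exact ofReal_div_ofReal_eq_top (M.H_pos (M.gap_pos hM s a ha)) hc

end Characteristic

/-! ### Continuity of the characteristic time, of oracle weights and of oracle policies. -/

namespace ConvergesTo

variable {ι S A : Type*} [Fintype S] [DecidableEq S] [Fintype A] [DecidableEq A] [Nonempty A]
  {Mt : ι → Model S A} {l : Filter ι} {M : Model S A}

theorem varV (h : ConvergesTo Mt l M) (hM : M.Admissible) (s : S) (a : A) :
    Tendsto (fun i => (Mt i).varV s a) l (𝓝 (M.varV s a)) :=
  tendsto_finsetSum _ fun s' _ => (h.p s a s').mul
    (((h.V hM s').sub (tendsto_finsetSum _ fun s'' _ => (h.p s a s'').mul (h.V hM s''))).pow 2)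

theorem spanV [Nonempty S] (h : ConvergesTo Mt l M) (hM : M.Admissible) :
    Tendsto (fun i => (Mt i).spanV) l (𝓝 M.spanV) :=
  (tendsto_iSup_of_finite (h.V hM)).sub (tendsto_iInf_of_finite (h.V hM))

theorem H [Nonempty S] (h : ConvergesTo Mt l M) (hM : M.Admissible) {s : S} {a : A}
    (ha : a ≠ M.optPolicy s) : Tendsto (fun i => (Mt i).H s a) l (𝓝 (M.H s a)) := by
  have hg := M.gap_pos hM s a ha
  refine (tendsto_const_nhds.div ((h.gap hM s a).pow 2) (by positivity)).add
    (((tendsto_const_nhds.mul (h.varV hM s a)).div ((h.gap hM s a).pow 2) (by positivity)).max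
      ((tendsto_const_nhds.mul ((h.spanV hM).rpow_const (Or.inr (by norm_num)))).div
        ((h.gap hM s a).rpow_const (Or.inr (by norm_num))) (by positivity)))

/-- The index set of the infimum depends on the optimal policy, which is eventually that of the
limit; after that it is a minimum over a fixed finite set. -/
theorem gapMin [Nonempty S] [Nontrivial A] (h : ConvergesTo Mt l M) (hM : M.Admissible) :
    Tendsto (fun i => (Mt i).gapMin) l (𝓝 M.gapMin) := by
  have := nonempty_nonoptimal M.optPolicy
  refine (tendsto_iInf_of_finite (κ := {z : S × A // z.2 ≠ M.optPolicy z.1})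
    fun z => h.gap hM z.1.1 z.1.2).congr' ?_
  filter_upwards [h.eventually_optimal hM] with i hi
  rw [Model.gapMin, hi.2]

theorem varMax [Nonempty S] (h : ConvergesTo Mt l M) (hM : M.Admissible) :
    Tendsto (fun i => (Mt i).varMax) l (𝓝 M.varMax) := by
  refine (tendsto_iSup_of_finite fun s => h.varV hM s (M.optPolicy s)).congr' ?_
  filter_upwards [h.eventually_optimal hM] with i hi
  rw [Model.varMax, hi.2]

theorem Hstar [Nonempty S] [Nontrivial A] (h : ConvergesTo Mt l M) (hM : M.Admissible) :
    Tendsto (fun i => (Mt i).Hstar) l (𝓝 M.Hstar) := by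
  have hg := M.gapMin_pos hM
  have hγ : 0 < 1 - M.γ := sub_pos.2 M.γ_lt_one
  have hG := h.gapMin hM
  unfold Model.Hstar Model.T3 Model.T4
  simp_rw [h.γ_eq]
  refine tendsto_const_nhds.mul ((tendsto_const_nhds.div ((hG.pow 2).mul_const _)
    (by positivity)).add ((tendsto_const_nhds.div ((hG.pow 2).mul_const _) (by positivity)).min
    (((tendsto_const_nhds.mul (h.varMax hM)).div ((hG.pow 2).mul_const _) (by positivity)).max
      ((tendsto_const_nhds.mul ((h.spanV hM).rpow_const (Or.inr (by norm_num)))).div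
        ((hG.rpow_const (Or.inr (by norm_num))).mul_const _) (by positivity)))))

/-- Joint continuity of the characteristic time in the model and the weights. -/
theorem U [Nonempty S] [Nontrivial A] (h : ConvergesTo Mt l M) (hM : M.Admissible)
    {x : ι → S → A → ℝ} {y : S → A → ℝ} (hx : Tendsto x l (𝓝 y)) :
    Tendsto (fun i => (Mt i).U (x i)) l (𝓝 (M.U y)) := by
  have hx : ∀ s a, Tendsto (fun i => x i s a) l (𝓝 (y s a)) := fun s a =>
    tendsto_pi_nhds.1 (tendsto_pi_nhds.1 hx s) a
  have := nonempty_nonoptimal M.optPolicy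
  have h1 : Tendsto (fun i => (⨆ z : {z : S × A // z.2 ≠ M.optPolicy z.1},
      ENNReal.ofReal ((Mt i).H z.1.1 z.1.2) / ENNReal.ofReal (x i z.1.1 z.1.2)) +
      ENNReal.ofReal (Mt i).Hstar /
        ENNReal.ofReal (Fintype.card S * ⨅ s, x i s (M.optPolicy s))) l (𝓝 (M.U y)) := by
    refine (tendsto_iSup_of_finite fun z => ?_).add ?_
    -- Division in `ENNReal` is continuous away from `0 / 0` and `∞ / ∞`; here the limiting
    -- numerator is positive and the denominator finite, so vanishing limit weights are allowed.
    · refine ENNReal.Tendsto.div (ENNReal.tendsto_ofReal (h.H hM z.2)) (Or.inl ?_)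
        (ENNReal.tendsto_ofReal (hx _ _)) (Or.inl ENNReal.ofReal_ne_top)
      simpa using M.H_pos (M.gap_pos hM _ _ z.2)
    · refine ENNReal.Tendsto.div (ENNReal.tendsto_ofReal (h.Hstar hM)) (Or.inl ?_)
        (ENNReal.tendsto_ofReal (tendsto_const_nhds.mul (tendsto_iInf_of_finite fun s => hx _ _)))
        (Or.inl ENNReal.ofReal_ne_top)
      simpa using M.Hstar_pos hM
  refine h1.congr' ?_
  filter_upwards [h.eventually_optimal hM] with i hi
  rw [Model.U, hi.2]

/-- Allocations of `Mt i` violate the flow equations of `M` only by weights in `[0, 1]` times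
differences of transition probabilities. -/
theorem allocations_diff (h : ConvergesTo Mt l M) {x : ι → S → A → ℝ}
    (hx : ∀ᶠ i in l, x i ∈ (Mt i).Allocations) (s : S) :
    Tendsto (fun i => ∑ a, x i s a - ∑ s', ∑ a', M.p s' a' s * x i s' a') l (𝓝 0) := by
  have h1 : Tendsto (fun i => ∑ s', ∑ a', x i s' a' * ((Mt i).p s' a' s - M.p s' a' s)) l
      (𝓝 (∑ s' : S, ∑ a' : A, 0)) := by
    refine tendsto_finsetSum _ fun s' _ => tendsto_finsetSum _ fun a' _ => ?_
    refine bdd_le_mul_tendsto_zero (b := 0) (B := 1) ?_ ?_ (tendsto_sub_nhds_zero_iff.2 (h.p _ _ _))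
    · filter_upwards [hx] with i hi using hi.1 _ _
    · filter_upwards [hx] with i hi using ((Mt i).allocation_mem_Icc hi).2 _ _
  simp only [Finset.sum_const_zero] at h1
  refine h1.congr' ?_
  filter_upwards [hx] with i hi
  rw [hi.2.2 s, ← Finset.sum_sub_distrib]
  refine Finset.sum_congr rfl fun s' _ => ?_
  rw [← Finset.sum_sub_distrib]
  exact Finset.sum_congr rfl fun a' _ => by ring

/-- Oracle weights are continuous at a model where they are unique. -/
theorem oracleWeights (h : ConvergesTo Mt l M) (hM : M.Admissible) {ωstar : S → A → ℝ}
    (hstar : M.IsOracleWeights ωstar) (huniq : ∀ ω, M.IsOracleWeights ω → ω = ωstar)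
    {x : ι → S → A → ℝ} (hx : ∀ᶠ i in l, (Mt i).IsOracleWeights (x i)) :
    Tendsto x l (𝓝 ωstar) := by
  obtain hS | hS := isEmpty_or_nonempty S
  · exact tendsto_const_nhds.congr fun i => Subsingleton.elim _ _
  have hpos := M.oracleWeights_pos hM hstar
  have hψ := isPolicy_policyOf hpos
  -- `ωstar` need not satisfy the flow equations of `Mt i`; the allocation of `Mt i` with the same
  -- policy does, and it tends to `ωstar`.
  choose w hw hwp using fun i => (Mt i).exists_allocation hψ
  have hw' : Tendsto w l (𝓝 ωstar) := by
    refine M.tendsto_allocation hM.1 hψ (policyOf_pos hpos) hstar.1 (policyOf_mul_sum hpos)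
      (Eventually.of_forall fun i => (Mt i).allocation_mem_Icc (hw i)) ?_
      (h.allocations_diff (Eventually.of_forall hw)) fun s a => ?_
    · exact tendsto_const_nhds.congr fun i => (hw i).2.1.symm
    · exact tendsto_const_nhds.congr fun i => (sub_eq_zero.2 (hwp i s a)).symm
  rw [tendsto_iff_ultrafilter]
  intro g hg
  have hxg : ∀ᶠ i in (g : Filter ι), (Mt i).IsOracleWeights (x i) := hg hx
  have hIcc : ∀ᶠ i in (g : Filter ι), x i ∈ Set.Icc (0 : S → A → ℝ) 1 := by
    filter_upwards [hxg] with i hi using (Mt i).allocation_mem_Icc hi.1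
  obtain ⟨y, -, hy⟩ := (isCompact_Icc (a := (0 : S → A → ℝ)) (b := 1)).ultrafilter_le_nhds'
    (g.map x) hIcc
  have hy : Tendsto x g (𝓝 y) := hy
  have hxy : ∀ s a, Tendsto (fun i => x i s a) g (𝓝 (y s a)) := fun s a =>
    tendsto_pi_nhds.1 (tendsto_pi_nhds.1 hy s) a
  have hys : y ∈ M.Allocations := by
    refine ⟨fun s a => ge_of_tendsto (hxy s a) ?_, ?_, fun s => ?_⟩
    · filter_upwards [hIcc] with i hi using hi.1 s a
    · refine tendsto_nhds_unique_of_eventuallyEq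
        (tendsto_finsetSum _ fun s _ => tendsto_finsetSum _ fun a _ => hxy s a)
        tendsto_const_nhds ?_
      filter_upwards [hxg] with i hi using hi.1.2.1
    · exact sub_eq_zero.1 <| tendsto_nhds_unique
        ((tendsto_finsetSum _ fun a _ => hxy s a).sub
          (tendsto_finsetSum _ fun s' _ => tendsto_finsetSum _ fun a' _ =>
            (hxy s' a').const_mul _))
        ((h.mono hg).allocations_diff (hxg.mono fun i hi => hi.1) s)
  -- Minimality against the competitor `w i` passes to the limit by joint continuity of `U`.
  have hU : M.U y ≤ M.U ωstar := by
    obtain hA | hA := subsingleton_or_nontrivial A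
    · rw [U_eq_zero_of_subsingleton]; exact zero_le
    · refine le_of_tendsto_of_tendsto ((h.mono hg).U hM hy)
        ((h.mono hg).U hM (hw'.mono_left hg)) ?_
      filter_upwards [hxg] with i hi using hi.2 _ (hw i)
  rw [← huniq y ⟨hys, fun ω' hω' => hU.trans (hstar.2 ω' hω')⟩]
  exact hy

/-- Oracle policies are continuous at a model where the oracle weights are unique. -/
theorem oraclePolicy (h : ConvergesTo Mt l M) (hM : M.Admissible) {ωstar : S → A → ℝ}
    (hstar : M.IsOracleWeights ωstar) (huniq : ∀ ω, M.IsOracleWeights ω → ω = ωstar)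
    {o : ι → S → A → ℝ} (ho : ∀ᶠ i in l, (Mt i).IsOraclePolicy (o i)) (s : S) (a : A) :
    Tendsto (fun i => o i s a) l (𝓝 (policyOf ωstar s a)) := by
  have hpos := M.oracleWeights_pos hM hstar
  have hex : ∀ i, ∃ x : S → A → ℝ, (Mt i).IsOraclePolicy (o i) →
      (Mt i).IsOracleWeights x ∧ ∀ s a, o i s a * ∑ b, x s b = x s a := fun i => by
    by_cases hi : (Mt i).IsOraclePolicy (o i)
    · obtain ⟨x, hx⟩ := hi.2
      exact ⟨x, fun _ => hx⟩
    · exact ⟨0, fun h => absurd h hi⟩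
  choose x hx using hex
  have hxt := h.oracleWeights hM hstar huniq (x := x) (ho.mono fun i hi => (hx i hi).1)
  have hxt : ∀ s a, Tendsto (fun i => x i s a) l (𝓝 (ωstar s a)) := fun s a =>
    tendsto_pi_nhds.1 (tendsto_pi_nhds.1 hxt s) a
  have hs : 0 < ∑ b, ωstar s b := Finset.sum_pos (fun b _ => hpos s b) Finset.univ_nonempty
  have hsum := tendsto_finsetSum Finset.univ fun b _ => hxt s b
  refine ((hxt s a).div hsum hs.ne').congr' ?_
  filter_upwards [ho, hsum.eventually_const_lt hs] with i hi hi'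
  exact (eq_div_of_mul_eq hi'.ne' ((hx i hi).2 s a)).symm

end ConvergesTo

end Model

/-! ### Kronecker's lemma for counting weights. -/

section Kronecker

/-- Kronecker's lemma for weights that count the ones of a binary sequence. -/
theorem kronecker_of_binary {J D : ℕ → ℝ} {c : ℝ} (hJ : ∀ k, J k = 0 ∨ J k = 1)
    (hJ' : Tendsto (fun t => ∑ k ∈ Finset.range t, J k) atTop atTop)
    (hD : Tendsto (fun t => ∑ k ∈ Finset.range t, D k / (1 + ∑ j ∈ Finset.range k, J j)) atTop
      (𝓝 c)) :
    Tendsto (fun t => (∑ k ∈ Finset.range t, D k) / (1 + ∑ k ∈ Finset.range t, J k)) atTop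
      (𝓝 0) := by
  have hJ0 : ∀ k, 0 ≤ J k := fun k => by rcases hJ k with h | h <;> simp [h]
  set w : ℕ → ℝ := fun t => 1 + ∑ k ∈ Finset.range t, J k with hw
  set X : ℕ → ℝ := fun t => ∑ k ∈ Finset.range t, D k / w k with hX
  have hw0 : ∀ t, 0 < w t := fun t =>
    add_pos_of_pos_of_nonneg one_pos (Finset.sum_nonneg fun k _ => hJ0 k)
  have hwt : Tendsto w atTop atTop := tendsto_atTop_add_const_left _ _ hJ'
  -- Abel summation with `w (t + 1) - w t = J t`. Centring at `c` turns the last sum into a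
  -- `J`-weighted sum of null terms, which is `o(w t)`.
  have habel : ∀ t, ∑ k ∈ Finset.range t, D k =
      w t * (X t - c) + c - ∑ k ∈ Finset.range t, J k * (X (k + 1) - c) := by
    intro t
    induction t with
    | zero => simp [hw, hX]
    | succ t ih =>
      have h1 : w (t + 1) = w t + J t := by simp only [hw, Finset.sum_range_succ]; ring
      have h2 : X (t + 1) = X t + D t / w t := by simp only [hX, Finset.sum_range_succ]
      have h3 : D t / w t * w t = D t := div_mul_cancel₀ _ (hw0 t).ne'
      rw [Finset.sum_range_succ, ih, Finset.sum_range_succ, h1, h2]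
      linear_combination -h3
  have hlo : (fun k => J k * (X (k + 1) - c)) =o[atTop] J := by
    have : (fun k => X (k + 1) - c) =o[atTop] (fun _ => (1 : ℝ)) :=
      (Asymptotics.isLittleO_one_iff ℝ).2
        (tendsto_sub_nhds_zero_iff.2 (hD.comp (tendsto_add_atTop_nat 1)))
    simpa using (Asymptotics.isBigO_refl J atTop).mul_isLittleO this
  have hlo' := hlo.sum_range hJ0 hJ'
  have hw1 : (fun t => ∑ k ∈ Finset.range t, J k) =O[atTop] w :=
    Asymptotics.IsBigO.of_bound 1 (Eventually.of_forall fun t => by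
      rw [Real.norm_of_nonneg (Finset.sum_nonneg fun k _ => hJ0 k),
        Real.norm_of_nonneg (hw0 t).le, one_mul]
      simp only [hw]
      linarith)
  have h3 := (hlo'.trans_isBigO hw1).tendsto_div_nhds_zero
  have h4 : Tendsto (fun t => c / w t) atTop (𝓝 0) := tendsto_const_nhds.div_atTop hwt
  have h5 : Tendsto (fun t => X t - c) atTop (𝓝 0) := tendsto_sub_nhds_zero_iff.2 hD
  have h6 := (h5.add h4).sub h3
  simp only [add_zero, sub_zero] at h6
  refine h6.congr fun t => ?_
  rw [habel t]
  have := (hw0 t).ne'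
  change _ = _ / w t
  field_simp

/-- When the counter moves from `w` to `w + 1`, `1 / w ^ 2 ≤ 2 / w - 2 / (w + 1)` for `w ≥ 1`, and
the sum telescopes. The resulting bound `2` is uniform over paths, so it bounds second moments of
martingales. -/
theorem sum_binary_div_sq_le {J : ℕ → ℝ} (hJ : ∀ k, J k = 0 ∨ J k = 1) (t : ℕ) :
    ∑ k ∈ Finset.range t, J k / (1 + ∑ j ∈ Finset.range k, J j) ^ 2 ≤
      2 - 2 / (1 + ∑ j ∈ Finset.range t, J j) := by
  have hJ0 : ∀ k, 0 ≤ J k := fun k => by rcases hJ k with h | h <;> simp [h]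
  induction t with
  | zero => simp
  | succ t ih =>
    rw [Finset.sum_range_succ, Finset.sum_range_succ]
    have hw : 1 ≤ 1 + ∑ j ∈ Finset.range t, J j :=
      le_add_of_nonneg_right (Finset.sum_nonneg fun k _ => hJ0 k)
    rcases hJ t with h | h
    · simpa [h] using ih
    · rw [h, ← add_assoc]
      generalize 1 + ∑ j ∈ Finset.range t, J j = w at ih hw
      have h1 : 1 / w ^ 2 ≤ 2 / w - 2 / (w + 1) := by
        rw [div_sub_div _ _ (by positivity) (by positivity), div_le_div_iff₀ (by positivity)
          (by positivity)]
        nlinarith [mul_nonneg (sub_nonneg.2 hw) (sub_nonneg.2 hw)]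
      linarith

end Kronecker

/-! ### Martingale convergence and the law of large numbers at random times. -/

section Martingale

variable {Ω : Type*} {mΩ : MeasurableSpace Ω} {μ : Measure Ω} [IsProbabilityMeasure μ]
  {ℱ : Filtration ℕ mΩ}

/-- A martingale with orthogonal-increment bound `E[Xₜ²] ≤ K` converges almost surely. -/
theorem ae_exists_tendsto_sum_of_condExp_eq_zero {Y : ℕ → Ω → ℝ} {Z : ℕ → Ω → ℝ} {C K : ℝ}
    (hYm : ∀ k, Measurable[ℱ (k + 1)] (Y k)) (hYC : ∀ k, ∀ᵐ x ∂μ, |Y k x| ≤ C)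
    (hY0 : ∀ k, μ[Y k | ℱ k] =ᵐ[μ] 0) (hZ : ∀ k, ∀ᵐ x ∂μ, Y k x ^ 2 ≤ Z k x)
    (hZi : ∀ k, Integrable (Z k) μ)
    (hK : ∀ t x, ∑ k ∈ Finset.range t, Z k x ≤ K) :
    ∀ᵐ x ∂μ, ∃ c, Tendsto (fun t => ∑ k ∈ Finset.range t, Y k x) atTop (𝓝 c) := by
  set X : ℕ → Ω → ℝ := fun t x => ∑ k ∈ Finset.range t, Y k x with hX
  have hYmeas : ∀ k, Measurable (Y k) := fun k => (hYm k).mono (ℱ.le _) le_rfl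
  have hYL : ∀ k, MemLp (Y k) ⊤ μ := fun k =>
    memLp_top_of_bound (hYmeas k).aestronglyMeasurable C (hYC k)
  have hXad : ∀ t, Measurable[ℱ t] (X t) := fun t =>
    Finset.measurable_sum _ fun k hk =>
      (hYm k).mono (ℱ.mono (Nat.succ_le_of_lt (Finset.mem_range.1 hk))) le_rfl
  have hXL : ∀ t, MemLp (X t) ⊤ μ := fun t => memLp_finsetSum _ fun k _ => hYL k
  have hXi : ∀ t, Integrable (X t) μ := fun t => (hXL t).integrable le_top
  have hXYi : ∀ t, Integrable (fun x => X t x * Y t x) μ := fun t =>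
    ((hYL t).mul (hXL t) (r := ⊤)).integrable le_top
  have hXXi : ∀ t, Integrable (fun x => X t x ^ 2) μ := fun t => by
    simp only [sq]
    exact ((hXL t).mul (hXL t) (r := ⊤)).integrable le_top
  have hYYi : ∀ t, Integrable (fun x => Y t x ^ 2) μ := fun t => by
    simp only [sq]
    exact ((hYL t).mul (hYL t) (r := ⊤)).integrable le_top
  have hsucc : ∀ t, X (t + 1) = X t + Y t := fun t => by
    funext x; simp [hX, Finset.sum_range_succ]
  have hmart : Martingale X ℱ μ := by
    refine martingale_of_condExp_sub_eq_zero_nat (fun t => (hXad t).stronglyMeasurable) hXi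
      fun t => ?_
    rw [hsucc, add_sub_cancel_left]
    exact hY0 t
  -- `X t` is known at time `t` and `Y t` has conditional mean zero, so second moments of increments
  -- add up.
  have hcross : ∀ t, ∫ x, X t x * Y t x ∂μ = 0 := fun t => by
    rw [← integral_condExp (ℱ.le t)]
    have h1 := condExp_mul_of_stronglyMeasurable_left (hXad t).stronglyMeasurable (hXYi t)
      ((hYL t).integrable le_top)
    rw [show (fun x => X t x * Y t x) = X t * Y t from rfl]
    rw [integral_congr_ae (g := fun _ => (0 : ℝ)), integral_zero]
    filter_upwards [h1, hY0 t] with x h1 h2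
    simp [h1, h2]
  have hsq : ∀ t, ∫ x, X t x ^ 2 ∂μ ≤ ∫ x, ∑ k ∈ Finset.range t, Z k x ∂μ := by
    intro t
    induction t with
    | zero => simp [hX]
    | succ t ih =>
      have h1 : ∫ x, X (t + 1) x ^ 2 ∂μ =
          ∫ x, X t x ^ 2 ∂μ + 2 * ∫ x, X t x * Y t x ∂μ + ∫ x, Y t x ^ 2 ∂μ := by
        have hXY2 : Integrable (fun x => X t x ^ 2 + 2 * (X t x * Y t x)) μ :=
          (hXXi t).add ((hXYi t).const_mul 2)
        rw [← integral_const_mul, ← integral_add (hXXi t) ((hXYi t).const_mul 2),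
          ← integral_add hXY2 (hYYi t)]
        refine integral_congr_ae (Eventually.of_forall fun x => ?_)
        simp only [hsucc, Pi.add_apply]
        ring
      have h2 : ∫ x, Y t x ^ 2 ∂μ ≤ ∫ x, Z t x ∂μ := integral_mono_ae (hYYi t) (hZi t) (hZ t)
      simp_rw [Finset.sum_range_succ]
      rw [h1, hcross, integral_add (integrable_finsetSum _ fun k _ => hZi k) (hZi t)]
      linarith
  have hsqK : ∀ t, ∫ x, X t x ^ 2 ∂μ ≤ K := fun t => (hsq t).trans <| by
    refine (integral_mono_ae (integrable_finsetSum _ fun k _ => hZi k) (integrable_const K)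
      (Eventually.of_forall (hK t))).trans_eq ?_
    simp
  -- The convergence theorem asks for bounded first moments; `|X| ≤ 1 + X ^ 2` derives them from the
  -- second moments.
  have hbdd : ∀ t, eLpNorm (X t) 1 μ ≤ (Real.toNNReal (1 + K) : ENNReal) := fun t => by
    rw [eLpNorm_one_eq_lintegral_enorm, ← ofReal_integral_norm_eq_lintegral_enorm (hXi t)]
    refine ENNReal.ofReal_le_ofReal ?_
    have h1 : ∫ x, ‖X t x‖ ∂μ ≤ ∫ x, (1 + X t x ^ 2) ∂μ := by
      refine integral_mono_ae (hXi t).norm ((integrable_const 1).add (hXXi t))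
        (Eventually.of_forall fun x => ?_)
      show |X t x| ≤ 1 + X t x ^ 2
      rw [← sq_abs]
      nlinarith [sq_nonneg (|X t x| - 1), abs_nonneg (X t x)]
    rw [integral_add (integrable_const 1) (hXXi t)] at h1
    have h2 := hsqK t
    simp only [integral_const, probReal_univ, smul_eq_mul, mul_one] at h1
    linarith
  exact hmart.submartingale.exists_ae_tendsto_of_bdd hbdd

/-- Law of large numbers for bounded martingale differences observed at random times: `J k`
indicates whether the `k`-th difference is observed. -/
theorem ae_tendsto_sum_div_count {D J : ℕ → Ω → ℝ} {C : ℝ}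
    (hDm : ∀ k, Measurable[ℱ (k + 1)] (D k)) (hJm : ∀ k, Measurable[ℱ (k + 1)] (J k))
    (hJ : ∀ k x, J k x = 0 ∨ J k x = 1) (hDJ : ∀ k, ∀ᵐ x ∂μ, |D k x| ≤ C * J k x)
    (hD0 : ∀ k, μ[D k | ℱ k] =ᵐ[μ] 0) :
    ∀ᵐ x ∂μ, Tendsto (fun t => ∑ k ∈ Finset.range t, J k x) atTop atTop →
      Tendsto (fun t => (∑ k ∈ Finset.range t, D k x) / (1 + ∑ k ∈ Finset.range t, J k x)) atTop
        (𝓝 0) := by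
  have hJ0 : ∀ k x, 0 ≤ J k x := fun k x => by rcases hJ k x with h | h <;> simp [h]
  have hJ1 : ∀ k x, J k x ≤ 1 := fun k x => by rcases hJ k x with h | h <;> simp [h]
  -- The count stops before round `k`, so `w k` is known at time `k` and dividing by it preserves
  -- conditional mean zero; the `1` keeps it away from zero.
  set w : ℕ → Ω → ℝ := fun k x => 1 + ∑ j ∈ Finset.range k, J j x with hw
  have hw1 : ∀ k x, 1 ≤ w k x := fun k x =>
    le_add_of_nonneg_right (Finset.sum_nonneg fun j _ => hJ0 j x)
  have hwm : ∀ k, Measurable[ℱ k] (w k) := fun k =>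
    measurable_const.add (Finset.measurable_sum _ fun j hj =>
      (hJm j).mono (ℱ.mono (Nat.succ_le_of_lt (Finset.mem_range.1 hj))) le_rfl)
  have hDC : ∀ k, ∀ᵐ x ∂μ, |D k x| ≤ |C| := fun k => by
    filter_upwards [hDJ k] with x hx
    calc |D k x| ≤ C * J k x := hx
      _ ≤ |C| * J k x := mul_le_mul_of_nonneg_right (le_abs_self C) (hJ0 k x)
      _ ≤ |C| * 1 := mul_le_mul_of_nonneg_left (hJ1 k x) (abs_nonneg C)
      _ = |C| := mul_one _
  have hDmeas : ∀ k, Measurable (D k) := fun k => (hDm k).mono (ℱ.le _) le_rfl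
  have hDi : ∀ k, Integrable (D k) μ := fun k =>
    (memLp_top_of_bound (hDmeas k).aestronglyMeasurable _ (hDC k)).integrable le_top
  have hYm : ∀ k, Measurable[ℱ (k + 1)] (fun x => D k x / w k x) := fun k =>
    (hDm k).div ((hwm k).mono (ℱ.mono (Nat.le_succ k)) le_rfl)
  have hYC : ∀ k, ∀ᵐ x ∂μ, |D k x / w k x| ≤ |C| := fun k => by
    filter_upwards [hDC k] with x hx
    rw [abs_div, abs_of_pos (one_pos.trans_le (hw1 k x))]
    exact (div_le_self (abs_nonneg _) (hw1 k x)).trans hx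
  have hY0 : ∀ k, μ[fun x => D k x / w k x | ℱ k] =ᵐ[μ] 0 := fun k => by
    have h1 : (fun x => D k x / w k x) = (w k)⁻¹ * D k := by
      funext x; simp [div_eq_inv_mul]
    have h2 : Integrable (fun x => D k x / w k x) μ :=
      (memLp_top_of_bound ((hYm k).mono (ℱ.le _) le_rfl).aestronglyMeasurable _
        (hYC k)).integrable le_top
    rw [h1] at h2 ⊢
    filter_upwards [condExp_mul_of_stronglyMeasurable_left (hwm k).inv.stronglyMeasurable h2
      (hDi k), hD0 k] with x hx hx'
    simp only [Pi.mul_apply, Pi.zero_apply] at hx hx' ⊢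
    rw [hx, hx', mul_zero]
  -- The normalized differences have squares at most `C ^ 2 * J / w ^ 2`, with pathwise sum at most
  -- `2 * C ^ 2`. Their series converges, and Kronecker's lemma gives the averages.
  have hconv := ae_exists_tendsto_sum_of_condExp_eq_zero (μ := μ) (ℱ := ℱ)
    (Y := fun k x => D k x / w k x) (Z := fun k x => C ^ 2 * (J k x / w k x ^ 2)) (C := |C|)
    (K := C ^ 2 * 2) hYm hYC hY0 (fun k => ?_) (fun k => ?_) (fun t x => ?_)
  · filter_upwards [hconv] with x ⟨c, hc⟩ hJt
    exact kronecker_of_binary (fun k => hJ k x) hJt hc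
  · filter_upwards [hDJ k] with x hx
    rw [div_pow, ← mul_div_assoc]
    refine div_le_div_of_nonneg_right ?_ (sq_nonneg _)
    rw [← sq_abs]
    rcases hJ k x with h | h
    · rw [h, mul_zero] at hx
      rw [le_antisymm hx (abs_nonneg _), h]
      simp
    · rw [h, mul_one] at hx ⊢
      exact pow_le_pow_left₀ (abs_nonneg _) hx 2
  · refine Integrable.const_mul ?_ _
    refine Integrable.of_bound (C := 1) ?_ (Eventually.of_forall fun x => ?_)
    · exact (((hJm k).mono (ℱ.le _) le_rfl).div
        (((hwm k).mono (ℱ.le _) le_rfl).pow_const 2)).aestronglyMeasurable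
    · have h1 : 1 ≤ w k x ^ 2 := one_le_pow₀ (hw1 k x)
      rw [Real.norm_of_nonneg (div_nonneg (hJ0 k x) (sq_nonneg _))]
      exact (div_le_self (hJ0 k x) h1).trans (hJ1 k x)
  · rw [← Finset.mul_sum]
    refine mul_le_mul_of_nonneg_left ((sum_binary_div_sq_le (fun k => hJ k x) t).trans ?_)
      (sq_nonneg C)
    have : 0 ≤ 2 / w t x := div_nonneg two_pos.le (one_pos.trans_le (hw1 t x)).le
    linarith

end Martingale

theorem cast_visits {S A : Type*} [DecidableEq S] [DecidableEq A] (st : ℕ → S) (act : ℕ → A)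
    (t : ℕ) (s : S) (a : A) :
    (visits st act t s a : ℝ) =
      ∑ k ∈ Finset.range t, if st k = s ∧ act k = a then (1 : ℝ) else 0 := by
  rw [visits, Finset.natCast_card_filter]

theorem cast_transCount {S A : Type*} [DecidableEq S] [DecidableEq A] (st : ℕ → S) (act : ℕ → A)
    (t : ℕ) (s : S) (a : A) (s' : S) :
    (transCount st act t s a s' : ℝ) =
      ∑ k ∈ Finset.range t, if (st k = s ∧ act k = a) ∧ st (k + 1) = s' then (1 : ℝ) else 0 := by
  rw [transCount, Finset.natCast_card_filter]

/-! ### Consistency of action, transition and reward averages. -/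

namespace IsInteraction

variable {S A Ω : Type*} [Fintype S] [DecidableEq S] [Fintype A] [DecidableEq A]
  {mΩ : MeasurableSpace Ω} {M : MDP S A} {μ : Measure Ω} [IsProbabilityMeasure μ]
  {ℱ : Filtration ℕ mΩ} {st : ℕ → Ω → S} {act : ℕ → Ω → A} {rew : ℕ → Ω → ℝ}
  {π : ℕ → Ω → S → A → ℝ}

theorem measurableSet_st (h : IsInteraction M μ ℱ st act rew π) {t n : ℕ} (hn : t ≤ n) (s : S) :
    MeasurableSet[ℱ n] {x | st t x = s} := ℱ.mono hn _ (h.st_meas t s)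

theorem measurableSet_act (h : IsInteraction M μ ℱ st act rew π) {t n : ℕ} (hn : t + 1 ≤ n)
    (a : A) : MeasurableSet[ℱ n] {x | act t x = a} := ℱ.mono hn _ (h.act_meas t a)

theorem measurableSet_pair (h : IsInteraction M μ ℱ st act rew π) {t n : ℕ} (hn : t + 1 ≤ n)
    (s : S) (a : A) : MeasurableSet[ℱ n] {x | st t x = s ∧ act t x = a} :=
  (h.measurableSet_st ((Nat.le_succ t).trans hn) s).inter (h.measurableSet_act hn a)

theorem measurableSet_rew (h : IsInteraction M μ ℱ st act rew π) (t : ℕ) {B : Set ℝ}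
    (hB : MeasurableSet B) : MeasurableSet {x | rew t x ∈ B} :=
  (h.rew_meas t).mono (ℱ.le _) le_rfl hB

theorem measurableSet_step (h : IsInteraction M μ ℱ st act rew π) (t : ℕ) (a : A) (s' : S)
    {B : Set ℝ} (hB : MeasurableSet B) :
    MeasurableSet {x | act t x = a ∧ rew t x ∈ B ∧ st (t + 1) x = s'} :=
  (ℱ.le _ _ (h.act_meas t a)).inter
    ((h.measurableSet_rew t hB).inter (ℱ.le _ _ (h.st_meas (t + 1) s')))

theorem condExp_act_rew (h : IsInteraction M μ ℱ st act rew π) (t : ℕ) (a : A) {B : Set ℝ}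
    (hB : MeasurableSet B) :
    μ[{x | act t x = a ∧ rew t x ∈ B}.indicator (fun _ => (1 : ℝ)) | ℱ t]
      =ᵐ[μ] fun x => π t x (st t x) a * (M.q (st t x) a).real B := by
  have h1 : {x | act t x = a ∧ rew t x ∈ B}.indicator (fun _ => (1 : ℝ)) =
      ∑ s', {x | act t x = a ∧ rew t x ∈ B ∧ st (t + 1) x = s'}.indicator
        (fun _ => (1 : ℝ)) := by
    funext x
    rw [Finset.sum_apply, Finset.sum_eq_single (st (t + 1) x)]
    · by_cases hx : act t x = a ∧ rew t x ∈ B <;> simp [Set.indicator, hx]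
    · intro s' _ hs'
      simp [hs'.symm]
    · simp
  rw [h1]
  have h2 := condExp_finsetSum (μ := μ) (m := ℱ t) (s := Finset.univ)
    (f := fun s' => {x | act t x = a ∧ rew t x ∈ B ∧ st (t + 1) x = s'}.indicator
        (fun _ => (1 : ℝ)))
    (fun s' _ => (integrable_const 1).indicator (h.measurableSet_step t a s' hB))
  have h3 := ae_all_iff.2 fun s' => h.step t a s' B hB
  filter_upwards [h2, h3] with x h2 h3
  rw [h2, Finset.sum_apply]
  simp_rw [h3, ← Finset.mul_sum, M.p_sum, mul_one]

theorem condExp_act_next (h : IsInteraction M μ ℱ st act rew π) (t : ℕ) (a : A) (s' : S) :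
    μ[{x | act t x = a ∧ st (t + 1) x = s'}.indicator (fun _ => (1 : ℝ)) | ℱ t]
      =ᵐ[μ] fun x => π t x (st t x) a * M.p (st t x) a s' := by
  have h1 := h.step t a s' Set.univ MeasurableSet.univ
  simp only [Set.mem_univ, true_and] at h1
  filter_upwards [h1] with x hx
  have := M.q_prob (st t x) a
  rw [hx, probReal_univ, one_mul]

theorem condExp_act (h : IsInteraction M μ ℱ st act rew π) (t : ℕ) (a : A) :
    μ[{x | act t x = a}.indicator (fun _ => (1 : ℝ)) | ℱ t]
      =ᵐ[μ] fun x => π t x (st t x) a := by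
  have h1 := h.condExp_act_rew t a MeasurableSet.univ
  simp only [Set.mem_univ, and_true] at h1
  filter_upwards [h1] with x hx
  have := M.q_prob (st t x) a
  rw [hx, probReal_univ, mul_one]

theorem integrable_act (h : IsInteraction M μ ℱ st act rew π) (t : ℕ) (a : A) :
    Integrable ({x | act t x = a}.indicator (fun _ => (1 : ℝ))) μ :=
  (integrable_const 1).indicator (ℱ.le _ _ (h.act_meas t a))

theorem integrable_act_next (h : IsInteraction M μ ℱ st act rew π) (t : ℕ) (a : A) (s' : S) :
    Integrable ({x | act t x = a ∧ st (t + 1) x = s'}.indicator (fun _ => (1 : ℝ))) μ :=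
  (integrable_const 1).indicator
    ((ℱ.le _ _ (h.act_meas t a)).inter (ℱ.le _ _ (h.st_meas (t + 1) s')))

/-- The conditional expectation of a function of the next state. -/
theorem condExp_next (h : IsInteraction M μ ℱ st act rew π) (t : ℕ) (f : S → ℝ) :
    μ[fun x => f (st (t + 1) x) | ℱ t]
      =ᵐ[μ] fun x => ∑ a, π t x (st t x) a * ∑ s', M.p (st t x) a s' * f s' := by
  have h1 : (fun x => f (st (t + 1) x)) = ∑ z : A × S, f z.2 •
      {x | act t x = z.1 ∧ st (t + 1) x = z.2}.indicator (fun _ => (1 : ℝ)) := by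
    funext x
    rw [Finset.sum_apply, Finset.sum_eq_single (act t x, st (t + 1) x)]
    · simp
    · rintro ⟨a, s'⟩ _ hz
      have : ¬(act t x = a ∧ st (t + 1) x = s') := fun hc => hz (by rw [hc.1, hc.2])
      simp [this]
    · simp
  rw [h1]
  have h2 := condExp_finsetSum (μ := μ) (m := ℱ t) (s := Finset.univ)
    (f := fun z : A × S => f z.2 •
      {x | act t x = z.1 ∧ st (t + 1) x = z.2}.indicator (fun _ => (1 : ℝ)))
    (fun z _ => (h.integrable_act_next t z.1 z.2).smul (f z.2))
  have h3 := ae_all_iff.2 fun z : A × S => condExp_smul (μ := μ) (f z.2)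
    ({x | act t x = z.1 ∧ st (t + 1) x = z.2}.indicator (fun _ => (1 : ℝ))) (ℱ t)
  have h4 := ae_all_iff.2 fun z : A × S => h.condExp_act_next t z.1 z.2
  filter_upwards [h2, h3, h4] with x h2 h3 h4
  rw [h2, Finset.sum_apply]
  simp_rw [h3, Pi.smul_apply, h4, Fintype.sum_prod_type, Finset.mul_sum, smul_eq_mul]
  exact Finset.sum_congr rfl fun a _ => Finset.sum_congr rfl fun s' _ => by ring

theorem ae_rew_mem_Icc (h : IsInteraction M μ ℱ st act rew π) (t : ℕ) :
    ∀ᵐ x ∂μ, rew t x ∈ Set.Icc (0 : ℝ) 1 := by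
  have hB : MeasurableSet (Set.Icc (0 : ℝ) 1)ᶜ := measurableSet_Icc.compl
  have h1 : ∀ a, ∀ᵐ x ∂μ, ¬(act t x = a ∧ rew t x ∈ (Set.Icc (0 : ℝ) 1)ᶜ) := fun a => by
    have hm : MeasurableSet {x | act t x = a ∧ rew t x ∈ (Set.Icc (0 : ℝ) 1)ᶜ} :=
      (ℱ.le _ _ (h.act_meas t a)).inter (h.measurableSet_rew t hB)
    have h2 := h.condExp_act_rew t a hB
    have h3 : ∫ x, {x | act t x = a ∧ rew t x ∈ (Set.Icc (0 : ℝ) 1)ᶜ}.indicator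
        (fun _ => (1 : ℝ)) x ∂μ = 0 := by
      rw [← integral_condExp (ℱ.le t), integral_congr_ae h2]
      simp [Measure.real, M.q_supp]
    rw [integral_indicator_const _ hm, smul_eq_mul, mul_one] at h3
    exact measure_eq_zero_iff_ae_notMem.1 ((measureReal_eq_zero_iff).1 h3)
  filter_upwards [ae_all_iff.2 h1] with x hx
  by_contra hc
  exact hx _ ⟨rfl, hc⟩

/-- Frequencies of actions follow the played policies. -/
theorem ae_tendsto_act (h : IsInteraction M μ ℱ st act rew π) (hπ : ∀ t x, IsPolicy (π t x))
    (s : S) (a : A) :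
    ∀ᵐ x ∂μ, Tendsto (fun t : ℕ => (∑ k ∈ Finset.range t,
      if st k x = s then (if act k x = a then (1 : ℝ) else 0) - π k x s a else 0) / (1 + t))
        atTop (𝓝 0) := by
  have hπ1 : ∀ t x s a, π t x s a ≤ 1 := fun t x s a => by
    rw [← (hπ t x s).2]
    exact Finset.single_le_sum (f := fun a => π t x s a) (fun b _ => (hπ t x s).1 b)
      (Finset.mem_univ a)
  have hDe : ∀ k, (fun x => if st k x = s then (if act k x = a then (1 : ℝ) else 0) - π k x s a
      else 0) = {x | st k x = s}.indicator
        ({x | act k x = a}.indicator (fun _ => (1 : ℝ)) - fun x => π k x s a) := fun k => by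
    funext x
    simp [Set.indicator_apply]
  have hπi : ∀ k, Integrable (fun x => π k x s a) μ := fun k =>
    Integrable.of_bound (C := 1) ((h.policy_meas k s a).mono (ℱ.le k) le_rfl).aestronglyMeasurable
      (Eventually.of_forall fun x => by
        rw [Real.norm_of_nonneg ((hπ k x s).1 a)]; exact hπ1 k x s a)
  -- Every round counts as observed here, so the normalization is `1 + t`.
  have hconv := ae_tendsto_sum_div_count (μ := μ) (ℱ := ℱ) (C := 1) (J := fun _ _ => 1)
    (D := fun k x => if st k x = s then (if act k x = a then (1 : ℝ) else 0) - π k x s a else 0)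
    (fun k => ?_) (fun k => measurable_const) (fun _ _ => Or.inr rfl)
    (fun k => Eventually.of_forall fun x => ?_) fun k => ?_
  · filter_upwards [hconv] with x hx
    have := hx (by simpa using tendsto_natCast_atTop_atTop)
    simpa using this
  · refine Measurable.ite (h.measurableSet_st (Nat.le_succ k) s) ?_ measurable_const
    exact (Measurable.ite (h.measurableSet_act le_rfl a) measurable_const measurable_const).sub
      ((h.policy_meas k s a).mono (ℱ.mono (Nat.le_succ k)) le_rfl)
  · have h0 := (hπ k x s).1 a
    have h1 := hπ1 k x s a
    rw [abs_le]
    split_ifs <;> constructor <;> linarith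
  · rw [hDe]
    refine (condExp_indicator ((h.integrable_act k a).sub (hπi k)) (h.st_meas k s)).trans ?_
    have h1 := condExp_sub (h.integrable_act k a) (hπi k) (ℱ k)
    rw [condExp_of_stronglyMeasurable (ℱ.le k) (h.policy_meas k s a).stronglyMeasurable
      (hπi k)] at h1
    filter_upwards [h1, h.condExp_act k a] with x h1 h2
    by_cases hs : st k x = s
    · rw [Set.indicator_of_mem (by exact hs), h1, Pi.sub_apply, h2, hs, sub_self, Pi.zero_apply]
    · rw [Set.indicator_of_notMem (by exact hs), Pi.zero_apply]

/-- Empirical transition frequencies are consistent at pairs that are visited infinitely often. -/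
theorem ae_tendsto_trans (h : IsInteraction M μ ℱ st act rew π) (s : S) (a : A) (s' : S) :
    ∀ᵐ x ∂μ, Tendsto (fun t => (visits (fun k => st k x) (fun k => act k x) t s a : ℝ)) atTop
        atTop → Tendsto (fun t =>
      (transCount (fun k => st k x) (fun k => act k x) t s a s' : ℝ) /
        visits (fun k => st k x) (fun k => act k x) t s a) atTop (𝓝 (M.p s a s')) := by
  set c := M.p s a s' with hc
  have hc0 : 0 ≤ c := M.p_nonneg _ _ _
  have hc1 : c ≤ 1 := by
    rw [hc, ← M.p_sum s a]
    exact Finset.single_le_sum (f := fun s' => M.p s a s') (fun b _ => M.p_nonneg _ _ _)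
      (Finset.mem_univ s')
  have hDe : ∀ k, (fun x => (if (st k x = s ∧ act k x = a) ∧ st (k + 1) x = s' then (1 : ℝ) else 0)
      - c * if st k x = s ∧ act k x = a then (1 : ℝ) else 0) = {x | st k x = s}.indicator
        ({x | act k x = a ∧ st (k + 1) x = s'}.indicator (fun _ => (1 : ℝ)) -
          c • {x | act k x = a}.indicator (fun _ => (1 : ℝ))) := fun k => by
    funext x
    by_cases hs : st k x = s <;> simp [Set.indicator_apply, hs]
  have hconv := ae_tendsto_sum_div_count (μ := μ) (ℱ := ℱ) (C := 1)
    (J := fun k x => if st k x = s ∧ act k x = a then (1 : ℝ) else 0)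
    (D := fun k x => (if (st k x = s ∧ act k x = a) ∧ st (k + 1) x = s' then (1 : ℝ) else 0)
      - c * if st k x = s ∧ act k x = a then (1 : ℝ) else 0)
    (fun k => ?_) (fun k => ?_) (fun k x => ?_)
    (fun k => Eventually.of_forall fun x => ?_) fun k => ?_
  · filter_upwards [hconv] with x hx hv
    simp only [Finset.sum_sub_distrib, ← Finset.mul_sum, ← cast_visits, ← cast_transCount] at hx
    have hx := hx hv
    -- Replaces the normalization `1 + N` of the law of large numbers by `N`.
    have h1 : Tendsto (fun t => (1 + (visits (fun k => st k x) (fun k => act k x) t s a : ℝ)) /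
        visits (fun k => st k x) (fun k => act k x) t s a) atTop (𝓝 1) := by
      have := (tendsto_inv_atTop_zero.comp hv).add_const 1
      rw [zero_add] at this
      refine this.congr' ?_
      filter_upwards [hv.eventually_gt_atTop 0] with t ht
      simp only [Function.comp_apply]
      field_simp
    have h2 := (hx.mul h1).add_const c
    rw [zero_mul, zero_add] at h2
    refine h2.congr' ?_
    filter_upwards [hv.eventually_gt_atTop 0] with t ht
    field_simp
    ring
  · exact (Measurable.ite ((h.measurableSet_pair le_rfl s a).inter (h.st_meas (k + 1) s'))
      measurable_const measurable_const).sub ((Measurable.ite (h.measurableSet_pair le_rfl s a)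
        measurable_const measurable_const).const_mul c)
  · exact Measurable.ite (h.measurableSet_pair le_rfl s a) measurable_const measurable_const
  · split_ifs <;> simp
  · by_cases hz : st k x = s ∧ act k x = a
    · by_cases hs : st (k + 1) x = s'
      · simp only [hz, hs, and_self, if_true, mul_one]
        rw [abs_le]; constructor <;> linarith
      · simp only [hz, hs, and_self, and_false, if_true, if_false, mul_one]
        rw [abs_le]; constructor <;> linarith
    · simp [hz]
  · rw [hDe]
    have hi := (h.integrable_act k a).smul c
    refine (condExp_indicator ((h.integrable_act_next k a s').sub hi) (h.st_meas k s)).trans ?_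
    filter_upwards [condExp_sub (h.integrable_act_next k a s') hi (ℱ k),
      condExp_smul (μ := μ) c ({x | act k x = a}.indicator (fun _ => (1 : ℝ))) (ℱ k),
      h.condExp_act k a, h.condExp_act_next k a s'] with x h1 h2 h3 h4
    by_cases hs : st k x = s
    · rw [Set.indicator_of_mem (by exact hs), h1, Pi.sub_apply, h2, Pi.smul_apply, h3, h4, hs,
        smul_eq_mul, Pi.zero_apply]
      ring
    · rw [Set.indicator_of_notMem (by exact hs), Pi.zero_apply]

/-- The interaction is specified only through probabilities of reward events. Hence the law of the
reward under `μ` restricted to the event is first identified with a multiple of `q(s, a)` on Borel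
sets, and then its mean is taken. -/
theorem setIntegral_rew (h : IsInteraction M μ ℱ st act rew π)
    (k : ℕ) (s : S) (a : A) {F : Set Ω} (hF : MeasurableSet[ℱ k] F) :
    ∫ x in F ∩ {x | st k x = s ∧ act k x = a}, rew k x ∂μ =
      μ.real (F ∩ {x | st k x = s ∧ act k x = a}) * ∫ y, y ∂(M.q s a) := by
  have := M.q_prob s a
  set E := F ∩ {x | st k x = s ∧ act k x = a} with hE
  have hEm : MeasurableSet E := (ℱ.le k _ hF).inter (ℱ.le _ _ (h.measurableSet_pair le_rfl s a))
  have hrm : Measurable (rew k) := (h.rew_meas k).mono (ℱ.le _) le_rfl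
  have hF' : MeasurableSet[ℱ k] (F ∩ {x | st k x = s}) := hF.inter (h.st_meas k s)
  have key : ∀ B : Set ℝ, MeasurableSet B → μ.real (E ∩ {x | rew k x ∈ B}) =
      (∫ x in F ∩ {x | st k x = s}, π k x s a ∂μ) * (M.q s a).real B := by
    intro B hB
    have hm : MeasurableSet {x | act k x = a ∧ rew k x ∈ B} :=
      (ℱ.le _ _ (h.act_meas k a)).inter (h.measurableSet_rew k hB)
    have h1 : ∫ x in F ∩ {x | st k x = s},
        {x | act k x = a ∧ rew k x ∈ B}.indicator (fun _ => (1 : ℝ)) x ∂μ =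
        μ.real (E ∩ {x | rew k x ∈ B}) := by
      rw [integral_indicator_const _ hm, smul_eq_mul, mul_one, measureReal_restrict_apply hm]
      congr 1
      ext x
      simp only [hE, Set.mem_inter_iff, Set.mem_ofPred_eq]
      tauto
    rw [← h1, ← setIntegral_condExp (ℱ.le k) ((integrable_const 1).indicator hm) hF',
      ← integral_mul_const]
    refine setIntegral_congr_ae (ℱ.le k _ hF') ?_
    filter_upwards [h.condExp_act_rew k a hB] with x hx hxs
    have hs : st k x = s := hxs.2
    rw [hx, hs]
  have hμE : μ.real E = ∫ x in F ∩ {x | st k x = s}, π k x s a ∂μ := by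
    simpa using key Set.univ MeasurableSet.univ
  have hmap : (μ.restrict E).map (rew k) = μ E • M.q s a := by
    ext B hB
    rw [Measure.map_apply hrm hB, Measure.restrict_apply (hrm hB), Measure.smul_apply, smul_eq_mul,
      ← ENNReal.toReal_eq_toReal_iff' (measure_ne_top _ _)
        (ENNReal.mul_ne_top (measure_ne_top _ _) (measure_ne_top _ _)), ENNReal.toReal_mul]
    have := key B hB
    rw [← hμE, Set.inter_comm] at this
    exact this
  have hmi : ∫ y, y ∂((μ.restrict E).map (rew k)) = ∫ x in E, rew k x ∂μ :=
    integral_map hrm.aemeasurable measurable_id.aestronglyMeasurable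
  rw [← hmi, hmap, integral_smul_measure, smul_eq_mul]
  rfl

/-- Empirical mean rewards are consistent at pairs that are visited infinitely often. -/
theorem ae_tendsto_rew (h : IsInteraction M μ ℱ st act rew π)
    (s : S) (a : A) :
    ∀ᵐ x ∂μ, Tendsto (fun t => (visits (fun k => st k x) (fun k => act k x) t s a : ℝ)) atTop
        atTop → Tendsto (fun t =>
      (∑ k ∈ Finset.range t, if st k x = s ∧ act k x = a then rew k x else 0) /
        visits (fun k => st k x) (fun k => act k x) t s a) atTop (𝓝 (∫ y, y ∂(M.q s a))) := by
  set c := ∫ y, y ∂(M.q s a) with hc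
  have hrm : ∀ k, Measurable (rew k) := fun k => (h.rew_meas k).mono (ℱ.le _) le_rfl
  have hbd : ∀ k, ∀ᵐ x ∂μ, |(if st k x = s ∧ act k x = a then rew k x else 0)
      - c * if st k x = s ∧ act k x = a then (1 : ℝ) else 0| ≤
      (1 + |c|) * if st k x = s ∧ act k x = a then (1 : ℝ) else 0 := fun k => by
    filter_upwards [h.ae_rew_mem_Icc k] with x hx
    split_ifs
    · rw [mul_one, mul_one]
      refine (abs_sub _ _).trans (add_le_add_left ?_ _)
      rw [abs_of_nonneg hx.1]
      exact hx.2
    · simp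
  have hDm : ∀ k, Measurable[ℱ (k + 1)] (fun x => (if st k x = s ∧ act k x = a then rew k x else 0)
      - c * if st k x = s ∧ act k x = a then (1 : ℝ) else 0) := fun k =>
    (Measurable.ite (h.measurableSet_pair le_rfl s a) (h.rew_meas k) measurable_const).sub
      ((Measurable.ite (h.measurableSet_pair le_rfl s a) measurable_const
        measurable_const).const_mul c)
  have hconv := ae_tendsto_sum_div_count (μ := μ) (ℱ := ℱ) (C := 1 + |c|)
    (J := fun k x => if st k x = s ∧ act k x = a then (1 : ℝ) else 0)
    (D := fun k x => (if st k x = s ∧ act k x = a then rew k x else 0)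
      - c * if st k x = s ∧ act k x = a then (1 : ℝ) else 0)
    hDm (fun k => ?_) (fun k x => ?_) hbd fun k => ?_
  · filter_upwards [hconv] with x hx hv
    simp only [Finset.sum_sub_distrib, ← Finset.mul_sum, ← cast_visits] at hx
    have hx := hx hv
    have h1 : Tendsto (fun t => (1 + (visits (fun k => st k x) (fun k => act k x) t s a : ℝ)) /
        visits (fun k => st k x) (fun k => act k x) t s a) atTop (𝓝 1) := by
      have := (tendsto_inv_atTop_zero.comp hv).add_const 1
      rw [zero_add] at this
      refine this.congr' ?_
      filter_upwards [hv.eventually_gt_atTop 0] with t ht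
      simp only [Function.comp_apply]
      field_simp
    have h2 := (hx.mul h1).add_const c
    rw [zero_mul, zero_add] at h2
    refine h2.congr' ?_
    filter_upwards [hv.eventually_gt_atTop 0] with t ht
    field_simp
    ring
  · exact Measurable.ite (h.measurableSet_pair le_rfl s a) measurable_const measurable_const
  · split_ifs <;> simp
  · have hE : MeasurableSet {x | st k x = s ∧ act k x = a} :=
      ℱ.le _ _ (h.measurableSet_pair le_rfl s a)
    have hi : Integrable (fun x => (if st k x = s ∧ act k x = a then rew k x else 0)
        - c * if st k x = s ∧ act k x = a then (1 : ℝ) else 0) μ :=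
      Integrable.of_bound (C := 1 + |c|) ((hDm k).mono (ℱ.le _) le_rfl).aestronglyMeasurable <| by
        filter_upwards [hbd k] with x hx
        refine hx.trans ?_
        have : 0 ≤ 1 + |c| := by positivity
        split_ifs
        · rw [mul_one]
        · simpa using this
    have hri : Integrable (rew k) μ :=
      Integrable.of_bound (C := 1) (hrm k).aestronglyMeasurable <| by
        filter_upwards [h.ae_rew_mem_Icc k] with x hx
        rw [Real.norm_of_nonneg hx.1]
        exact hx.2
    refine (ae_eq_condExp_of_forall_setIntegral_eq (ℱ.le k) hi (g := fun _ => (0 : ℝ))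
      (fun _ _ _ => integrableOn_zero) (fun F hF _ => ?_) aestronglyMeasurable_const).symm
    have hDe : (fun x => (if st k x = s ∧ act k x = a then rew k x else 0)
        - c * if st k x = s ∧ act k x = a then (1 : ℝ) else 0) =
        {x | st k x = s ∧ act k x = a}.indicator (fun x => rew k x - c) := by
      funext x
      by_cases hz : st k x = s ∧ act k x = a <;> simp [hz]
    rw [hDe, setIntegral_indicator hE, integral_sub hri.integrableOn (integrable_const c),
      h.setIntegral_rew k s a hF, setIntegral_const]
    simp [hc]

end IsInteraction

theorem tendsto_visits_of_frequently {S A : Type*} [DecidableEq S] [DecidableEq A] (st : ℕ → S)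
    (act : ℕ → A) (s : S) (a : A) (h : ∀ n, ∃ t, n ≤ t ∧ st t = s ∧ act t = a) :
    Tendsto (fun t => visits st act t s a) atTop atTop := by
  have hmono : Monotone fun t => visits st act t s a := fun t t' ht =>
    Finset.card_le_card (Finset.filter_subset_filter _ (Finset.range_mono ht))
  refine tendsto_atTop_atTop_of_monotone hmono fun b => ?_
  induction b with
  | zero => exact ⟨0, Nat.zero_le _⟩
  | succ b ih =>
    obtain ⟨t, ht⟩ := ih
    obtain ⟨j, hj, hja⟩ := h t
    refine ⟨j + 1, ?_⟩
    have h1 : visits st act (j + 1) s a = visits st act j s a + 1 := by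
      rw [visits, Finset.range_add_one, Finset.filter_insert, if_pos hja,
        Finset.card_insert_of_notMem (by simp)]
      rfl
    rw [h1]
    exact Nat.succ_le_succ (ht.trans (hmono hj))

/-! ### Every pair is visited infinitely often. -/

namespace IsInteraction

variable {S A Ω : Type*} [Fintype S] [DecidableEq S] [Fintype A] [DecidableEq A]
  {mΩ : MeasurableSpace Ω} {M : MDP S A} {μ : Measure Ω} [IsProbabilityMeasure μ]
  {ℱ : Filtration ℕ mΩ} {st : ℕ → Ω → S} {act : ℕ → Ω → A} {rew : ℕ → Ω → ℝ}
  {π : ℕ → Ω → S → A → ℝ}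

/-- The event that a pair is visited in one of the rounds `t, …, t + n`. -/
def hitEvent (st : ℕ → Ω → S) (act : ℕ → Ω → A) (s : S) (a : A) (t n : ℕ) : Set Ω :=
  {x | ∃ j ≤ n, st (t + j) x = s ∧ act (t + j) x = a}

theorem measurableSet_hitEvent (h : IsInteraction M μ ℱ st act rew π) (s : S) (a : A)
    {t n k : ℕ} (hk : t + n + 1 ≤ k) : MeasurableSet[ℱ k] (hitEvent st act s a t n) := by
  have : hitEvent st act s a t n =
      ⋃ j ∈ Finset.range (n + 1), {x | st (t + j) x = s ∧ act (t + j) x = a} := by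
    ext x
    simp only [hitEvent, Set.mem_ofPred_eq, Set.mem_iUnion, Finset.mem_range, Nat.lt_succ_iff,
      exists_prop]
  rw [this]
  refine Finset.measurableSet_biUnion _ fun j hj => h.measurableSet_pair ?_ s a
  have := Finset.mem_range.1 hj
  omega

theorem integrable_hitEvent (h : IsInteraction M μ ℱ st act rew π) (s : S) (a : A) (t n : ℕ) :
    Integrable ((hitEvent st act s a t n).indicator (1 : Ω → ℝ)) μ :=
  (integrable_const 1).indicator (ℱ.le _ _ (h.measurableSet_hitEvent s a le_rfl))

theorem hitEvent_mono (s : S) (a : A) (t : ℕ) {n n' : ℕ} (hn : n ≤ n') :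
    hitEvent st act s a t n ⊆ hitEvent st act s a t n' :=
  fun _ ⟨j, hj, hz⟩ => ⟨j, hj.trans hn, hz⟩

/-- When every action has probability at least `δ`, a pair is reached along the path of a
deterministic policy with probability at least `δ ^ (n + 1)` times that of the path. -/
theorem le_condExp_hitEvent (h : IsInteraction M μ ℱ st act rew π)
    (hπ : ∀ t x, IsPolicy (π t x)) {δ : ℝ} (hδ0 : 0 ≤ δ) (ψ : S → A) (s : S) (a : A) (n t : ℕ)
    (hδ : ∀ j, t ≤ j → j ≤ t + n → ∀ x s a, δ ≤ π j x s a) :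
    ∀ᵐ x ∂μ, δ ^ (n + 1) * (M.toModel.detKernel ψ ^ n) (st t x) s ≤
      (μ[(hitEvent st act s a t n).indicator (1 : Ω → ℝ) | ℱ t]) x := by
  induction n generalizing t with
  | zero =>
    have h1 : (hitEvent st act s a t 0).indicator (1 : Ω → ℝ) = {x | st t x = s}.indicator
        ({x | act t x = a}.indicator (fun _ => (1 : ℝ))) := by
      funext x
      by_cases hs : st t x = s <;> by_cases ha : act t x = a <;>
        simp [hitEvent, Set.indicator, hs, ha]
    rw [h1]
    filter_upwards [condExp_indicator (h.integrable_act t a) (h.st_meas t s),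
      h.condExp_act t a] with x hx1 hx2
    rw [hx1]
    by_cases hs : st t x = s
    · rw [Set.indicator_of_mem (by exact hs), hx2]
      simpa [hs] using hδ t le_rfl (by omega) x s a
    · rw [Set.indicator_of_notMem (by exact hs)]
      simp [hs]
  | succ n ih =>
    have ih' := ih (t + 1) fun j hj hj' => hδ j (by omega) (by omega)
    -- Restart after one round: a hit in the window that begins at `t + 1` is a hit in the longer
    -- window, and the tower property brings in the induction hypothesis.
    have hsub : (hitEvent st act s a (t + 1) n).indicator (1 : Ω → ℝ) ≤
        (hitEvent st act s a t (n + 1)).indicator (1 : Ω → ℝ) := by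
      refine Set.indicator_le_indicator_of_subset ?_ fun _ => zero_le_one
      rintro x ⟨j, hj, hz⟩
      exact ⟨j + 1, Nat.succ_le_succ hj, by rwa [← add_assoc, add_right_comm]⟩
    have h1 := condExp_mono (m := ℱ t) (h.integrable_hitEvent s a (t + 1) n)
      (h.integrable_hitEvent s a t (n + 1)) (Eventually.of_forall hsub)
    have h2 := condExp_condExp_of_le (μ := μ)
      (f := (hitEvent st act s a (t + 1) n).indicator (1 : Ω → ℝ))
      (ℱ.mono (Nat.le_succ t)) (ℱ.le (t + 1))
    have hfi : Integrable
        (fun x => δ ^ (n + 1) * (M.toModel.detKernel ψ ^ n) (st (t + 1) x) s) μ := by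
      have hm : Measurable
          (fun x => δ ^ (n + 1) * (M.toModel.detKernel ψ ^ n) (st (t + 1) x) s) := by
        let _ : MeasurableSpace S := ⊤
        refine (measurable_from_top (f := fun s' : S =>
          δ ^ (n + 1) * (M.toModel.detKernel ψ ^ n) s' s)).comp (measurable_to_countable' fun s' => ?_)
        exact ℱ.le _ _ (h.st_meas (t + 1) s')
      refine Integrable.of_bound (C := δ ^ (n + 1)) hm.aestronglyMeasurable
        (Eventually.of_forall fun x => ?_)
      have h0 := fun s' => M.toModel.detKernel_pow_nonneg ψ n (st (t + 1) x) s'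
      have h1 : (M.toModel.detKernel ψ ^ n) (st (t + 1) x) s ≤ 1 := by
        rw [← M.toModel.detKernel_pow_sum ψ n (st (t + 1) x)]
        exact Finset.single_le_sum (f := fun s' => (M.toModel.detKernel ψ ^ n) (st (t + 1) x) s')
          (fun s' _ => h0 s') (Finset.mem_univ s)
      rw [Real.norm_of_nonneg (mul_nonneg (pow_nonneg hδ0 _) (h0 s))]
      exact mul_le_of_le_one_right (pow_nonneg hδ0 _) h1
    have h3 := condExp_mono (m := ℱ t) hfi integrable_condExp ih'
    have h4 := h.condExp_next t fun s' => δ ^ (n + 1) * (M.toModel.detKernel ψ ^ n) s' s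
    filter_upwards [h1, h2, h3, h4] with x h1 h2 h3 h4
    refine le_trans ?_ h1
    rw [← h2]
    refine le_trans ?_ h3
    rw [h4]
    have hf0 : ∀ b, 0 ≤ ∑ s', M.p (st t x) b s' *
        (δ ^ (n + 1) * (M.toModel.detKernel ψ ^ n) s' s) := fun b =>
      Finset.sum_nonneg fun s' _ => mul_nonneg (M.p_nonneg _ _ _)
        (mul_nonneg (pow_nonneg hδ0 _) (M.toModel.detKernel_pow_nonneg _ _ _ _))
    -- Among all actions only the one prescribed by `ψ` is kept, at the cost of one factor `δ`.
    refine le_trans ?_ (Finset.single_le_sum (f := fun b => π t x (st t x) b * ∑ s',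
      M.p (st t x) b s' * (δ ^ (n + 1) * (M.toModel.detKernel ψ ^ n) s' s))
      (fun b _ => mul_nonneg ((hπ t x _).1 b) (hf0 b)) (Finset.mem_univ (ψ (st t x))))
    refine le_trans (le_of_eq ?_) (mul_le_mul_of_nonneg_right
      (hδ t le_rfl (by omega) x (st t x) (ψ (st t x))) (hf0 _))
    rw [pow_succ' (M.toModel.detKernel ψ), Matrix.mul_apply, Finset.mul_sum, Finset.mul_sum]
    refine Finset.sum_congr rfl fun s' _ => ?_
    simp only [Model.detKernel, MDP.toModel, Matrix.of_apply]
    ring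

/-- In a communicating model, a pair is visited within `diam + 1` rounds with probability at least
a constant times the `(diam + 1)`-th power of the exploration rate. -/
theorem exists_le_condExp_hitEvent (h : IsInteraction M μ ℱ st act rew π)
    (hπ : ∀ t x, IsPolicy (π t x)) (hM : M.toModel.Communicating) (s : S) :
    ∃ c > 0, ∀ (a : A) (t : ℕ) (δ : ℝ), 0 ≤ δ → δ ≤ 1 →
      (∀ j, t ≤ j → j ≤ t + M.toModel.diam → ∀ x s a, δ ≤ π j x s a) →
      ∀ᵐ x ∂μ, c * δ ^ (M.toModel.diam + 1) ≤
        (μ[(hitEvent st act s a t M.toModel.diam).indicator (1 : Ω → ℝ) | ℱ t]) x := by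
  set m := M.toModel.diam with hm
  have hex : ∀ s₀, ∃ n ≤ m, ∃ ψ : S → A, 0 < (M.toModel.detKernel ψ ^ n) s₀ s := fun s₀ => by
    have hne : {n : ℕ | 1 ≤ n ∧ ∃ π : S → A, 0 < (M.toModel.detKernel π ^ n) s₀ s}.Nonempty :=
      hM s₀ s
    refine ⟨_, ?_, (Nat.sInf_mem hne).2⟩
    exact Finset.le_sup (f := fun z : S × S =>
      sInf {n : ℕ | 1 ≤ n ∧ ∃ π : S → A, 0 < (M.toModel.detKernel π ^ n) z.1 z.2})
      (Finset.mem_univ (s₀, s))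
  choose n hn ψ hψ using hex
  have : Nonempty S := ⟨s⟩
  -- The constant is the least path probability over the starting states. Path lengths differ, but
  -- `δ ≤ 1` lets the power `m + 1` bound them all.
  obtain ⟨s₁, hs₁⟩ := Finite.exists_min fun s₀ => (M.toModel.detKernel (ψ s₀) ^ n s₀) s₀ s
  refine ⟨_, hψ s₁, fun a t δ hδ0 hδ1 hδ => ?_⟩
  have h1 := ae_all_iff.2 fun s₀ => h.le_condExp_hitEvent hπ hδ0 (ψ s₀) s a (n s₀) t
    fun j hj hj' => hδ j hj (hj'.trans (Nat.add_le_add_left (hn s₀) t))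
  have h2 := ae_all_iff.2 fun s₀ => condExp_mono (m := ℱ t) (h.integrable_hitEvent s a t (n s₀))
    (h.integrable_hitEvent s a t m) (Eventually.of_forall fun x =>
      Set.indicator_le_indicator_of_subset (hitEvent_mono s a t (hn s₀))
        (fun _ => zero_le_one) x)
  filter_upwards [h1, h2] with x h1 h2
  refine le_trans ?_ ((h1 (st t x)).trans (h2 (st t x)))
  rw [mul_comm]
  exact mul_le_mul (pow_le_pow_of_le_one hδ0 hδ1 (Nat.succ_le_succ (hn _))) (hs₁ _)
    (hψ s₁).le (pow_nonneg hδ0 _)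

/-- Exploration at rate `t ^ (-1 / (diam + 1))` visits every pair infinitely often. -/
theorem ae_tendsto_visits (h : IsInteraction M μ ℱ st act rew π)
    (hπ : ∀ t x, IsPolicy (π t x)) (hM : M.toModel.Communicating) {κ : ℝ} (hκ0 : 0 < κ)
    (hκ1 : κ ≤ 1)
    (hκ : ∀ t : ℕ, 1 ≤ t → ∀ x s a,
      κ * (t : ℝ) ^ (-(1 / ((M.toModel.diam : ℝ) + 1))) ≤ π t x s a) (s : S) (a : A) :
    ∀ᵐ x ∂μ, Tendsto (fun t => visits (fun k => st k x) (fun k => act k x) t s a) atTop atTop := by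
  obtain ⟨c, hc, hbound⟩ := h.exists_le_condExp_hitEvent hπ hM s
  set m := M.toModel.diam with hm
  have hm0 : (0 : ℝ) < (m : ℝ) + 1 := by positivity
  set L := m + 1 with hL
  -- Time is sampled every `L` rounds: a visit in the rounds `k * L, …, k * L + m` is decided at
  -- time `(k + 1) * L`.
  let 𝒢 : Filtration ℕ mΩ :=
    { seq := fun k => ℱ (k * L)
      mono' := fun i j hij => ℱ.mono (Nat.mul_le_mul_right L hij)
      le' := fun k => ℱ.le _ }
  let E : ℕ → Set Ω := fun k => match k with
    | 0 => ∅
    | k + 1 => hitEvent st act s a (k * L) m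
  have hE : ∀ k, MeasurableSet[𝒢 k] (E k) := fun k => match k with
    | 0 => @MeasurableSet.empty Ω (𝒢 0)
    | k + 1 => h.measurableSet_hitEvent s a (k := (k + 1) * L) (by
        have : (k + 1) * L = k * L + L := Nat.succ_mul k L
        omega)
  have hBC := ae_mem_limsup_atTop_iff (ℱ := 𝒢) μ hE
  set C := c * κ ^ L / L with hC
  have hL0 : (0 : ℝ) < L := by simp only [hL]; positivity
  have hC0 : 0 < C := by positivity
  -- The correction at `k = 0` discards the block starting at round `0`, where no rate is assumed;
  -- it costs only the constant `C` in the divergent sum.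
  have hlow : ∀ k : ℕ, ∀ᵐ x ∂μ, C * (1 / ((k : ℝ) + 1)) - (if k = 0 then C else 0) ≤
      (μ[(E (k + 1)).indicator (1 : Ω → ℝ) | 𝒢 k]) x := by
    intro k
    rcases Nat.eq_zero_or_pos k with rfl | hk
    · have := condExp_nonneg (μ := μ) (m := 𝒢 0) (f := (E (0 + 1)).indicator (1 : Ω → ℝ))
        (Eventually.of_forall fun x => Set.indicator_nonneg (fun _ _ => zero_le_one) x)
      filter_upwards [this] with x hx
      simpa using hx
    · have hkL : 1 ≤ k * L := Nat.mul_pos hk (Nat.succ_pos m)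
      -- The last round of the block, where the guaranteed rate is smallest.
      set T : ℝ := ((k * L + m : ℕ) : ℝ) with hT
      have hT1 : 1 ≤ T := by rw [hT]; exact_mod_cast hkL.trans (Nat.le_add_right _ _)
      have hT0 : 0 < T := by linarith
      have hrate : T ^ (-(1 / ((m : ℝ) + 1))) ≤ 1 :=
        Real.rpow_le_one_of_one_le_of_nonpos hT1 (by simp only [neg_nonpos]; positivity)
      have hb := hbound a (k * L) (κ * T ^ (-(1 / ((m : ℝ) + 1)))) (by positivity)
        (mul_le_one₀ hκ1 (by positivity) hrate) fun j hj hj' x s a => by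
          have hj1 : 1 ≤ j := hkL.trans hj
          refine le_trans (mul_le_mul_of_nonneg_left ?_ hκ0.le) (hκ j hj1 x s a)
          exact Real.rpow_le_rpow_of_nonpos (by exact_mod_cast hj1)
            (by rw [hT]; exact_mod_cast hj') (by simp only [neg_nonpos]; positivity)
      filter_upwards [hb] with x hx
      refine le_trans ?_ hx
      -- The exponent of the exploration rate is exactly the one that produces a harmonic lower
      -- bound.
      have hpow : (T ^ (-(1 / ((m : ℝ) + 1)))) ^ L = T⁻¹ := by
        rw [← Real.rpow_natCast, ← Real.rpow_mul hT0.le, ← Real.rpow_neg_one]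
        congr 1
        rw [hL, Nat.cast_add_one]
        field_simp
      have hTle : T ≤ L * ((k : ℝ) + 1) := by
        rw [hT, hL]; push_cast; nlinarith
      rw [if_neg hk.ne', sub_zero, mul_pow, hpow, hC, ← mul_assoc, div_mul_div_comm, mul_one,
        ← div_eq_mul_inv]
      exact div_le_div_of_nonneg_left (by positivity) hT0 hTle
  filter_upwards [hBC, ae_all_iff.2 hlow] with x hx hl
  have hdiv : Tendsto (fun n => ∑ k ∈ Finset.range n,
      (μ[(E (k + 1)).indicator (1 : Ω → ℝ) | 𝒢 k]) x) atTop atTop := by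
    have h1 : Tendsto (fun n => C * ∑ k ∈ Finset.range n, (1 / ((k : ℝ) + 1)) - C) atTop atTop :=
      tendsto_atTop_add_const_right _ _
        (Real.tendsto_sum_range_one_div_nat_succ_atTop.const_mul_atTop hC0)
    refine tendsto_atTop_mono (fun n => ?_) h1
    refine le_trans ?_ (Finset.sum_le_sum fun k _ => hl k)
    rw [Finset.sum_sub_distrib, ← Finset.mul_sum]
    refine sub_le_sub_left ?_ _
    rw [Finset.sum_ite_eq']
    split_ifs
    · exact le_rfl
    · exact hC0.le
  have hmem := hx.2 hdiv
  rw [mem_limsup_iff_frequently_mem, frequently_atTop] at hmem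
  refine tendsto_visits_of_frequently _ _ s a fun n => ?_
  obtain ⟨k, hk, hxk⟩ := hmem (n + 1)
  match k, hk, hxk with
  | k + 1, hk, ⟨j, _, hj⟩ =>
    refine ⟨k * L + j, ?_, hj⟩
    have : k * 1 ≤ k * L := Nat.mul_le_mul_left k (Nat.succ_le_succ (Nat.zero_le m))
    omega

end IsInteraction

/-! ### Properties of the played policies. -/

section Policies

variable {S A : Type*} [Fintype A] [Nonempty A]

/-- The policy that is mixed with the uniform policy in a navigation rule. -/
def navTarget (rule : NavRule) (o : ℕ → S → A → ℝ) (t : ℕ) (s : S) (a : A) : ℝ :=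
  match rule with
  | .cNavigation => (∑ j ∈ Finset.Icc 1 t, o j s a) / t
  | .dNavigation => o t s a

theorem navPolicy_of_pos (rule : NavRule) (ε : ℕ → ℝ) (o : ℕ → S → A → ℝ) {t : ℕ} (ht : 1 ≤ t)
    (s : S) (a : A) : navPolicy rule ε o t s a =
      ε t * uniformPolicy S A s a + (1 - ε t) * navTarget rule o t s a := by
  unfold navPolicy
  rw [if_neg (by omega)]
  rfl

theorem isPolicy_navTarget (rule : NavRule) {o : ℕ → S → A → ℝ}
    (ho : ∀ t, 1 ≤ t → IsPolicy (o t)) {t : ℕ} (ht : 1 ≤ t) : IsPolicy (navTarget rule o t) := by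
  cases rule with
  | dNavigation => exact ho t ht
  | cNavigation =>
    have ht0 : (t : ℝ) ≠ 0 := by exact_mod_cast (by omega : t ≠ 0)
    refine fun s => ⟨fun a => div_nonneg (Finset.sum_nonneg fun j hj =>
      (ho j (Finset.mem_Icc.1 hj).1 s).1 a) (Nat.cast_nonneg _), ?_⟩
    simp only [navTarget]
    rw [← Finset.sum_div, Finset.sum_comm,
      Finset.sum_congr rfl fun j hj => (ho j (Finset.mem_Icc.1 hj).1 s).2]
    simp [ht0]

theorem isPolicy_navPolicy (rule : NavRule) {ε : ℕ → ℝ} (h0 : ∀ t, 1 ≤ t → 0 ≤ ε t)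
    (h1 : ∀ t, 1 ≤ t → ε t ≤ 1) {o : ℕ → S → A → ℝ} (ho : ∀ t, 1 ≤ t → IsPolicy (o t)) (t : ℕ) :
    IsPolicy (navPolicy rule ε o t) := by
  have hu : IsPolicy (uniformPolicy S A) := fun s =>
    ⟨fun a => by unfold uniformPolicy; positivity, by simp [uniformPolicy]⟩
  rcases Nat.eq_zero_or_pos t with rfl | ht
  · intro s
    simpa [navPolicy] using hu s
  · intro s
    have hn := isPolicy_navTarget rule ho ht s
    simp_rw [navPolicy_of_pos rule ε o ht]
    refine ⟨fun a => add_nonneg (mul_nonneg (h0 t ht) ((hu s).1 a))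
      (mul_nonneg (sub_nonneg.2 (h1 t ht)) (hn.1 a)), ?_⟩
    rw [Finset.sum_add_distrib, ← Finset.mul_sum, ← Finset.mul_sum, (hu s).2, hn.2]
    ring

theorem le_navPolicy (rule : NavRule) {ε : ℕ → ℝ} (h1 : ∀ t, 1 ≤ t → ε t ≤ 1)
    {o : ℕ → S → A → ℝ} (ho : ∀ t, 1 ≤ t → IsPolicy (o t)) {t : ℕ} (ht : 1 ≤ t) (s : S) (a : A) :
    ε t * uniformPolicy S A s a ≤ navPolicy rule ε o t s a := by
  rw [navPolicy_of_pos rule ε o ht]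
  exact le_add_of_nonneg_right (mul_nonneg (sub_nonneg.2 (h1 t ht))
    ((isPolicy_navTarget rule ho ht s).1 a))

/-- The uniform part vanishes with `ε`; averaging the oracle policies preserves their limit by
Cesàro's theorem. -/
theorem tendsto_navPolicy (rule : NavRule) {ε : ℕ → ℝ} (hε : Tendsto ε atTop (𝓝 0))
    {o : ℕ → S → A → ℝ} {s : S} {a : A} {c : ℝ} (ho : Tendsto (fun t => o t s a) atTop (𝓝 c)) :
    Tendsto (fun t => navPolicy rule ε o t s a) atTop (𝓝 c) := by
  have hT : Tendsto (fun t => navTarget rule o t s a) atTop (𝓝 c) := by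
    cases rule with
    | dNavigation => exact ho
    | cNavigation =>
      refine ((tendsto_add_atTop_iff_nat 1).2 ho).cesaro.congr fun t => ?_
      have h1 : ∑ j ∈ Finset.Icc 1 t, o j s a = ∑ i ∈ Finset.range t, o (i + 1) s a := by
        induction t with
        | zero => simp
        | succ t ih => rw [Finset.sum_Icc_succ_top (by omega), ih, Finset.sum_range_succ]
      simp only [navTarget]
      rw [h1, div_eq_inv_mul]
  have h1 := (hε.mul_const (uniformPolicy S A s a)).add ((hε.const_sub 1).mul hT)
  simp only [zero_mul, sub_zero, one_mul, zero_add] at h1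
  refine h1.congr' ?_
  filter_upwards [eventually_ge_atTop 1] with t ht
  rw [navPolicy_of_pos rule ε o ht]

end Policies

/-! ### Visit frequencies along a fixed trajectory. -/

section Counts

variable {S A : Type*} [Fintype S] [DecidableEq S] [Fintype A] [DecidableEq A]

theorem sum_visits_action (st : ℕ → S) (act : ℕ → A) (t : ℕ) (s : S) :
    ∑ a, (visits st act t s a : ℝ) = ∑ k ∈ Finset.range t, if st k = s then (1 : ℝ) else 0 := by
  simp_rw [cast_visits]
  rw [Finset.sum_comm]
  refine Finset.sum_congr rfl fun k _ => ?_
  by_cases hs : st k = s <;> simp [hs]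

theorem sum_visits (st : ℕ → S) (act : ℕ → A) (t : ℕ) :
    ∑ s, ∑ a, (visits st act t s a : ℝ) = t := by
  simp_rw [sum_visits_action]
  rw [Finset.sum_comm]
  simp

theorem sum_transCount_target (st : ℕ → S) (act : ℕ → A) (t : ℕ) (s' : S) :
    ∑ s, ∑ a, (transCount st act t s a s' : ℝ) =
      ∑ k ∈ Finset.range t, if st (k + 1) = s' then (1 : ℝ) else 0 := by
  simp_rw [cast_transCount]
  rw [← Fintype.sum_prod_type', Finset.sum_comm]
  refine Finset.sum_congr rfl fun k _ => ?_
  rw [Finset.sum_eq_single (st k, act k)]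
  · simp
  · rintro ⟨s, a⟩ _ hz
    rw [if_neg]
    rintro ⟨⟨h1, h2⟩, -⟩
    exact hz (by rw [h1, h2])
  · simp

theorem visits_le (st : ℕ → S) (act : ℕ → A) (t : ℕ) (s : S) (a : A) :
    visits st act t s a ≤ t :=
  (Finset.card_filter_le _ _).trans_eq (Finset.card_range t)

theorem visits_div_mem_Icc (st : ℕ → S) (act : ℕ → A) (t : ℕ) :
    (fun s a => (visits st act t s a : ℝ) / t) ∈ Set.Icc (0 : S → A → ℝ) 1 :=
  ⟨fun _ _ => div_nonneg (Nat.cast_nonneg _) (Nat.cast_nonneg _), fun _ _ =>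
    div_le_one_of_le₀ (Nat.cast_le.2 (visits_le st act t _ _)) (Nat.cast_nonneg _)⟩

/-- Along a trajectory with consistent transition frequencies whose actions asymptotically follow
a full-support policy, visit frequencies converge to the stationary allocation of the policy. -/
theorem tendsto_visits_div (M : Model S A) (hM : M.Communicating) {ψ : S → A → ℝ}
    (hψ : IsPolicy ψ) (hpos : ∀ s a, 0 < ψ s a) {ω : S → A → ℝ} (hω : ω ∈ M.Allocations)
    (h : ∀ s a, ω s a = ψ s a * ∑ b, ω s b) {st : ℕ → S} {act : ℕ → A} {π : ℕ → S → A → ℝ}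
    (hπ : ∀ s a, Tendsto (fun t => π t s a) atTop (𝓝 (ψ s a)))
    (hvisits : ∀ s a, Tendsto (fun t => (visits st act t s a : ℝ)) atTop atTop)
    (htrans : ∀ s a s', Tendsto
      (fun t => (transCount st act t s a s' : ℝ) / visits st act t s a) atTop (𝓝 (M.p s a s')))
    (hact : ∀ s a, Tendsto (fun t : ℕ => (∑ k ∈ Finset.range t,
      if st k = s then (if act k = a then (1 : ℝ) else 0) - π k s a else 0) / (1 + t))
        atTop (𝓝 0)) (s : S) (a : A) :
    Tendsto (fun t : ℕ => (visits st act t s a : ℝ) / t) atTop (𝓝 (ω s a)) := by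
  have main := M.tendsto_allocation hM hψ hpos hω h
    (x := fun t : ℕ => fun s a => (visits st act t s a : ℝ) / t) (l := atTop)
    (Eventually.of_forall fun t => visits_div_mem_Icc st act t) ?_ ?_ ?_
  · exact tendsto_pi_nhds.1 (tendsto_pi_nhds.1 main s) a
  · refine tendsto_const_nhds.congr' ?_
    filter_upwards [eventually_ge_atTop 1] with t ht
    have ht0 : (t : ℝ) ≠ 0 := by exact_mod_cast (by omega : t ≠ 0)
    simp_rw [← Finset.sum_div, sum_visits, div_self ht0]
  · intro s
    -- Exits from `s` minus entries to `s` telescope to this boundary term.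
    have h1 : Tendsto (fun t : ℕ => ((if st 0 = s then (1 : ℝ) else 0) -
        if st t = s then (1 : ℝ) else 0) / t) atTop (𝓝 0) := by
      have : Tendsto (fun t : ℕ => ((if st 0 = s then (1 : ℝ) else 0) -
        if st t = s then (1 : ℝ) else 0) * ((t : ℝ))⁻¹) atTop (𝓝 0) := by
        refine bdd_le_mul_tendsto_zero (b := -1) (B := 1) (Eventually.of_forall fun t => ?_)
          (Eventually.of_forall fun t => ?_) tendsto_inv_atTop_nhds_zero_nat
        all_goals split_ifs <;> norm_num
      simpa only [div_eq_mul_inv] using this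
    -- What remains of the flow defect is the error of the empirical transition frequencies,
    -- weighted by visit frequencies in `[0, 1]`.
    have h2 : Tendsto (fun t : ℕ => ∑ s', ∑ a', (visits st act t s' a' : ℝ) / t *
        ((transCount st act t s' a' s : ℝ) / visits st act t s' a' - M.p s' a' s)) atTop
        (𝓝 (∑ _s' : S, ∑ _a' : A, 0)) := by
      refine tendsto_finsetSum _ fun s' _ => tendsto_finsetSum _ fun a' _ => ?_
      exact bdd_le_mul_tendsto_zero (b := 0) (B := 1)
        (Eventually.of_forall fun t => (visits_div_mem_Icc st act t).1 s' a')
        (Eventually.of_forall fun t => (visits_div_mem_Icc st act t).2 s' a')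
        (tendsto_sub_nhds_zero_iff.2 (htrans s' a' s))
    simp only [Finset.sum_const_zero] at h2
    have h3 := h1.add h2
    rw [add_zero] at h3
    refine h3.congr' ?_
    have hev : ∀ᶠ t in atTop, ∀ s a, (0 : ℝ) < visits st act t s a := by
      simp_rw [eventually_all]
      exact fun s a => (hvisits s a).eventually_gt_atTop 0
    filter_upwards [hev] with t ht
    have htel : ∑ k ∈ Finset.range t, (if st k = s then (1 : ℝ) else 0) -
        ∑ k ∈ Finset.range t, (if st (k + 1) = s then (1 : ℝ) else 0) =
        (if st 0 = s then (1 : ℝ) else 0) - if st t = s then (1 : ℝ) else 0 := by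
      rw [← Finset.sum_sub_distrib,
        Finset.sum_range_sub' (fun k => if st k = s then (1 : ℝ) else 0)]
    rw [← htel, ← sum_visits_action st act, ← sum_transCount_target st act, sub_div]
    simp_rw [Finset.sum_div]
    rw [sub_add, ← Finset.sum_sub_distrib]
    congr 1
    refine Finset.sum_congr rfl fun s' _ => ?_
    rw [← Finset.sum_sub_distrib]
    refine Finset.sum_congr rfl fun a' _ => ?_
    have := (ht s' a').ne'
    field_simp
    ring
  · intro s a
    have h1 : Tendsto (fun t : ℕ => (1 + (t : ℝ)) / t) atTop (𝓝 1) := by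
      have := (tendsto_inv_atTop_nhds_zero_nat (𝕜 := ℝ)).add_const 1
      rw [zero_add] at this
      refine this.congr' ?_
      filter_upwards [eventually_ge_atTop 1] with t ht
      have ht0 : (t : ℝ) ≠ 0 := by exact_mod_cast (by omega : t ≠ 0)
      field_simp
    -- The policy defect is the martingale average in `hact` plus the Cesàro mean of these null
    -- terms.
    have h2 : Tendsto (fun k => (if st k = s then (1 : ℝ) else 0) * (π k s a - ψ s a)) atTop
        (𝓝 0) := by
      refine bdd_le_mul_tendsto_zero (b := 0) (B := 1) (Eventually.of_forall fun t => ?_)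
        (Eventually.of_forall fun t => ?_) (tendsto_sub_nhds_zero_iff.2 (hπ s a))
      all_goals split_ifs <;> norm_num
    have h3 := ((hact s a).mul h1).add h2.cesaro
    rw [zero_mul, zero_add] at h3
    refine h3.congr' ?_
    filter_upwards [eventually_ge_atTop 1] with t ht
    have ht0 : (t : ℝ) ≠ 0 := by exact_mod_cast (by omega : t ≠ 0)
    have ht1 : (1 + t : ℝ) ≠ 0 := by positivity
    rw [← Finset.sum_div, sum_visits_action, cast_visits, div_mul_div_cancel₀ ht1,
      inv_mul_eq_div, ← add_div, ← mul_div_assoc, ← sub_div, ← Finset.sum_add_distrib,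
      Finset.mul_sum, ← Finset.sum_sub_distrib]
    congr 1
    refine Finset.sum_congr rfl fun k _ => ?_
    by_cases hs : st k = s <;> by_cases ha : act k = a <;> simp [hs, ha]; ring

end Counts

end NavMDP

end

/-! ### Almost sure convergence of the visit frequencies. -/

theorem mainTheorem2
    {S A Ω : Type*} [Fintype S] [DecidableEq S] [Fintype A] [DecidableEq A] [Nonempty A]
    {mΩ : MeasurableSpace Ω} (μ : Measure Ω) [IsProbabilityMeasure μ]
    -- the true MDP: communicating, unique optimal policy, aperiodic under the uniform policy
    (M : NavMDP.MDP S A)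
    (hM : M.toModel.Admissible)
    (hap : M.toModel.UniformAperiodic)
    -- its oracle weights
    (ωstar : S → A → ℝ)
    (hstar : M.toModel.IsOracleWeights ωstar)
    (huniq : ∀ ω, M.toModel.IsOracleWeights ω → ω = ωstar)
    -- the exploration rates
    (ε : ℕ → ℝ)
    (hε_le : ∀ t, 1 ≤ t → ε t ≤ 1)
    (hε_anti : ∀ t, 1 ≤ t → ε (t + 1) ≤ ε t)
    (hε_lower : ∀ t : ℕ, 1 ≤ t → (t : ℝ) ^ (-(1 / ((M.toModel.diam : ℝ) + 1))) ≤ ε t)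
    (hε_lim : Tendsto ε atTop (𝓝 0))
    -- the trajectory of the learner and the oracle policies of the empirical models
    (rule : NavMDP.NavRule)
    (ℱ : Filtration ℕ mΩ)
    (st : ℕ → Ω → S) (act : ℕ → Ω → A) (rew : ℕ → Ω → ℝ)
    (o : ℕ → Ω → S → A → ℝ)
    (ho_meas : ∀ t, 1 ≤ t → ∀ s a, Measurable[ℱ t] fun x => o t x s a)
    (ho_policy : ∀ t, 1 ≤ t → ∀ x, NavMDP.IsPolicy (o t x))
    (ho_oracle : ∀ t, 1 ≤ t → ∀ x,
      let Mhat := NavMDP.empModel M.γ M.γ_nonneg M.γ_lt_one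
        (fun k => st k x) (fun k => act k x) (fun k => rew k x) t
      (∀ s a, 0 < NavMDP.visits (fun k => st k x) (fun k => act k x) t s a) →
      Mhat.Admissible → Mhat.IsOraclePolicy (o t x))
    (hrun : NavMDP.IsInteraction M μ ℱ st act rew
      (fun t x => NavMDP.navPolicy rule ε (fun j => o j x) t)) :
    ∀ᵐ x ∂μ, ∀ s a,
      Tendsto (fun t : ℕ =>
        (NavMDP.visits (fun k => st k x) (fun k => act k x) t s a : ℝ) / t)
        atTop (𝓝 (ωstar s a)) := by
  have hε0 : ∀ t, 1 ≤ t → 0 ≤ ε t := fun t ht =>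
    (Real.rpow_nonneg (Nat.cast_nonneg t) _).trans (hε_lower t ht)
  have hπ : ∀ t x, NavMDP.IsPolicy (NavMDP.navPolicy rule ε (fun j => o j x) t) := fun t x =>
    NavMDP.isPolicy_navPolicy rule hε0 hε_le (fun t ht => ho_policy t ht x) t
  have hA : (0 : ℝ) < Fintype.card A := by exact_mod_cast Fintype.card_pos
  have hA1 : (1 : ℝ) ≤ Fintype.card A := by exact_mod_cast Fintype.card_pos
  have hexplore : ∀ t : ℕ, 1 ≤ t → ∀ x s a, 1 / (Fintype.card A : ℝ) *
      (t : ℝ) ^ (-(1 / ((M.toModel.diam : ℝ) + 1))) ≤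
        NavMDP.navPolicy rule ε (fun j => o j x) t s a := fun t ht x s a => by
    refine le_trans ?_ (NavMDP.le_navPolicy rule hε_le (fun t ht => ho_policy t ht x) ht s a)
    rw [mul_comm]
    exact mul_le_mul_of_nonneg_right (hε_lower t ht) (one_div_pos.2 hA).le
  have hv := ae_all_iff.2 fun s => ae_all_iff.2 fun a =>
    hrun.ae_tendsto_visits hπ hM.1 (one_div_pos.2 hA) ((div_le_one hA).2 hA1) hexplore s a
  have hp := ae_all_iff.2 fun s => ae_all_iff.2 fun a => ae_all_iff.2 fun s' =>
    hrun.ae_tendsto_trans s a s'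
  have hr := ae_all_iff.2 fun s => ae_all_iff.2 fun a => hrun.ae_tendsto_rew s a
  have ha := ae_all_iff.2 fun s => ae_all_iff.2 fun a => hrun.ae_tendsto_act hπ s a
  filter_upwards [hv, hp, hr, ha] with x hv hp hr ha
  -- From here on the trajectory is fixed and the argument is deterministic.
  have hv' : ∀ s a, Tendsto
      (fun t => (NavMDP.visits (fun k => st k x) (fun k => act k x) t s a : ℝ)) atTop atTop :=
    fun s a => tendsto_natCast_atTop_atTop.comp (hv s a)
  have hconv : NavMDP.Model.ConvergesTo (fun t => NavMDP.empModel M.γ M.γ_nonneg M.γ_lt_one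
      (fun k => st k x) (fun k => act k x) (fun k => rew k x) t) atTop M.toModel := by
    refine ⟨fun _ => rfl, fun s a s' => ?_, fun s a => hr s a (hv' s a)⟩
    -- The uniform default at unvisited pairs is eventually irrelevant.
    refine (hp s a s' (hv' s a)).congr' ?_
    filter_upwards [(hv s a).eventually_gt_atTop 0] with t ht
    exact (if_neg ht.ne').symm
  have hvis : ∀ᶠ t in atTop, ∀ s a,
      0 < NavMDP.visits (fun k => st k x) (fun k => act k x) t s a := by
    simp_rw [eventually_all]
    exact fun s a => (hv s a).eventually_gt_atTop 0
  have hor := hconv.oraclePolicy hM hstar huniq (o := fun t => o t x) (by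
    filter_upwards [hvis, hconv.eventually_optimal hM, eventually_ge_atTop 1] with t h1 h2 h3
    exact ho_oracle t h3 x h1 h2.1)
  have hpos := M.toModel.oracleWeights_pos hM hstar
  exact NavMDP.tendsto_visits_div M.toModel hM.1 (NavMDP.Model.isPolicy_policyOf hpos)
    (NavMDP.Model.policyOf_pos hpos) hstar.1 (NavMDP.Model.policyOf_mul_sum hpos)
    (fun s a => NavMDP.tendsto_navPolicy rule hε_lim (hor s a)) hv'
    (fun s a s' => hp s a s' (hv' s a)) ha
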